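/- All matroids are finite. For a matroid $\mathsf M$ of rank $k$ on the ground set $E$, let $\mathscr L(\mathsf M)$ be its lattice of flats; for a flat $F$ let $\mathsf M^F$ be the restriction of $\mathsf M$ to $F$ and $\mathsf M_F$ the contraction of $\mathsf M$ by $F$. Let $\chi_{\mathsf M}(t)$ be the characteristic polynomial of $\mathscr L(\mathsf M)$, and let $P_{\mathsf M}(t)\in\mathbb Z[t]$ be the Kazhdan–Lusztig polynomial of $\mathsf M$: $P_{\mathsf M}=1$ if $E=\varnothing$, $P_{\mathsf M}=0$ if $\mathsf M$ has a loop, and, for loopless $\mathsf M$ of rank $k>0$, $\deg P_{\mathsf M}<k/2$ and $$t^{k}P_{\mathsf M}(t^{-1})=\sum_{F\in\mathscr L(\mathsf M)}\chi_{\mathsf M^F}(t)\,P_{\mathsf M_F}(t).$$ Let $Z_{\mathsf M}(t)=\sum_{F\in\mathscr L(\mathsf M)}t^{\operatorname{rk}(F)}P_{\mathsf M_F}(t)$, a palindromic polynomial of degree $k$. The $\gamma$-polynomial of $\mathsf M$ is $\gamma_{\mathsf M}(t)=\sum_{i=0}^{\lfloor k/2\rfloor}\gamma_i t^i$, where the integers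 $\gamma_i$ are determined by $Z_{\mathsf M}(t)=\sum_{i=0}^{\lfloor k/2\rfloor}\gamma_i\,t^i(1+t)^{k-2i}$. Let $\mathsf U_{k,n}$ be the uniform matroid of rank $k$ on $n$ elements. For $h\ge k\ge 1$ put $$g_{k,h}(t)=\gamma_{\mathsf U_{k,h+1}}(t)-\gamma_{\mathsf U_{k-1,h}}(t).$$ **Theorem.** (a) Let $\mathsf M$ be a paving matroid of rank $k$ on $n$ elements (every circuit has at least $k$ elements), and for each $h\ge k$ let $\lambda_h$ be the number of hyperplanes (flats of rank $k-1$) of $\mathsf M$ of cardinality $h$. Then $$\gamma_{\mathsf M}(t)=\gamma_{\mathsf U_{k,n}}(t)-\sum_{h\ge k}\lambda_h\,g_{k,h}(t).$$ (If $k=0$ there are no hyperplanes, and the sum is $0$.) (b) For all integers $h\ge k\ge 1$, the polynomial $g_{k,h}(t)$ has non-negative coefficients and degree $\lfloor k/2\rfloor$. (For $k=1$ it is the zero polynomial, whose degree is read as $0$ here.) -/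

import Mathlib

open Polynomial

namespace Matroid

variable {α : Type*}

/-! ### Rank, flats, hyperplanes, paving matroids -/

/-- The rank of a set, as a natural number (meaningful for finite matroids). -/
noncomputable def natRk (M : Matroid α) (A : Set α) : ℕ := (M.eRk A).toNat

/-- The rank of the matroid, as a natural number (meaningful for finite matroids). -/
noncomputable def natRank (M : Matroid α) : ℕ := M.natRk M.E

/-- The flats of `M`, partially ordered by inclusion. -/
abbrev Flats (M : Matroid α) : Type _ := {F : Set α // M.IsFlat F}

instance finite_flats (M : Matroid α) [M.Finite] : Finite M.Flats :=
  Set.Finite.subset M.ground_finite.finite_subsets (fun _ hF => hF.subset_ground)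

noncomputable instance fintypeFlats (M : Matroid α) [M.Finite] : Fintype M.Flats :=
  Fintype.ofFinite _

open Classical in
noncomputable instance locallyFiniteOrderFlats (M : Matroid α) [M.Finite] :
    LocallyFiniteOrder M.Flats :=
  Fintype.toLocallyFiniteOrder

/-- The least flat, consisting of the loops of `M`. -/
def botFlat (M : Matroid α) : M.Flats := ⟨M.closure ∅, isFlat_closure _⟩

/-- A hyperplane is a flat of rank `rk M - 1`. -/
def IsHyperplaneFlat (M : Matroid α) (H : Set α) : Prop :=
  M.IsFlat H ∧ M.eRk H + 1 = M.eRank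

/-- The number of hyperplanes of cardinality `h`. -/
noncomputable def numHyperplanes (M : Matroid α) (h : ℕ) : ℕ :=
  {H : Set α | M.IsHyperplaneFlat H ∧ H.encard = h}.ncard

/-- A matroid of rank `k` is paving if all its circuits have size at least `k`. -/
def IsPaving (M : Matroid α) : Prop := ∀ C, M.IsCircuit C → M.eRank ≤ C.encard

/-! ### Kazhdan--Lusztig polynomial and `Z`-polynomial -/

open Classical in
/-- The characteristic polynomial `∑_F μ(⊥, F) t ^ (rk M - rk F)` of the lattice of flats. -/
noncomputable def charPoly (M : Matroid α) [M.Finite] : ℤ[X] :=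
  ∑ F : M.Flats, C (IncidenceAlgebra.mu ℤ M.botFlat F) * X ^ (M.natRank - M.natRk F.1)

/-- The localization of `M` at the flat `F`. -/
def localization (M : Matroid α) (F : M.Flats) : Matroid α := M ↾ F.1

instance finite_localization (M : Matroid α) [M.Finite] (F : M.Flats) :
    (M.localization F).Finite :=
  restrict_finite (M.ground_finite.subset F.2.subset_ground)

lemma ncard_contract_lt (M : Matroid α) [M.Finite] (F : M.Flats) (hF : F.1 ≠ ∅) :
    (M ／ F.1).E.ncard < M.E.ncard := by
  refine Set.ncard_lt_ncard ?_ M.ground_finite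
  obtain ⟨e, he⟩ := Set.nonempty_iff_ne_empty.2 hF
  exact ⟨Set.sdiff_subset, fun h => (h (F.2.subset_ground he)).2 he⟩

open Classical in
/-- The Kazhdan--Lusztig polynomial of a finite matroid.

It is `1` for the empty matroid and `0` for a matroid with loops (in particular for a non-empty
matroid of rank `0`). For a non-empty loopless `M` of rank `k` it is the polynomial `P` of degree
`< k / 2` with `t ^ k * P (1 / t) = ∑_F χ_{M ↾ F} (t) * P_{M ／ F} (t)`, the sum being over all
flats `F`. The flat `F = ∅` contributes `P` itself and `t ^ k * P (1 / t)` has no terms of degree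
`≤ k / 2`, so for `i < k / 2` the `i`-th coefficient of `P` is minus that of the sum over the
non-empty flats; see `klPoly_unique` below. -/
noncomputable def klPoly (M : Matroid α) [M.Finite] : ℤ[X] :=
  if M.E = ∅ then 1
  else if M.Loopless then
    ∑ i ∈ (Finset.range M.natRank).filter (fun i => 2 * i < M.natRank),
      monomial i (-(∑ F : {F : M.Flats // F.1 ≠ ∅},
        (M.localization F.1).charPoly * (M ／ F.1.1).klPoly).coeff i)
  else 0
termination_by M.E.ncard
decreasing_by exact M.ncard_contract_lt F.1 F.2

/-- The `Z`-polynomial `∑_F t ^ rk F * P_{M ／ F} (t)`. -/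
noncomputable def zPoly (M : Matroid α) [M.Finite] : ℤ[X] :=
  ∑ F : M.Flats, X ^ M.natRk F.1 * (M ／ F.1).klPoly

end Matroid

/-! ### `γ`-polynomials -/

/-- The coefficients `γ_m` in `f = ∑ m, γ_m t ^ m (1 + t) ^ (d - 2 m)`, found by comparing the
coefficients of `t ^ m`. -/
noncomputable def gammaCoeff (f : ℤ[X]) (d : ℕ) (m : ℕ) : ℤ :=
  f.coeff m - ∑ i : Fin m, gammaCoeff f d i * ((d - 2 * i.1).choose (m - i.1) : ℤ)
termination_by m
decreasing_by exact i.2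

/-- The `γ`-polynomial of a palindromic polynomial `f` of degree `d`: the polynomial
`∑_{i ≤ d / 2} γ_i t ^ i` where `f = ∑_{i ≤ d / 2} γ_i t ^ i (1 + t) ^ (d - 2 i)`;
see `gammaPoly_expansion` and `gammaPoly_unique`. -/
noncomputable def gammaPoly (f : ℤ[X]) : ℤ[X] :=
  ∑ i ∈ Finset.range (f.natDegree / 2 + 1), monomial i (gammaCoeff f f.natDegree i)

/-- The `γ`-polynomial of a matroid. -/
noncomputable def Matroid.gamma {α : Type*} (M : Matroid α) [M.Finite] : ℤ[X] :=
  gammaPoly M.zPoly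

/-! ### Uniform matroids -/

/-- The uniform matroid `U_{k,n}` on `Fin n`, for `k ≤ n`: a set is independent if it has at most
`k` elements, so the bases are the sets with `k` elements. -/
def uniformMatroid (k n : ℕ) : Matroid (Fin n) :=
  (IndepMatroid.ofFinite (E := Set.univ) Set.finite_univ (fun I => I.ncard ≤ k)
    (by simp)
    (fun I J hJ hIJ => (Set.ncard_le_ncard hIJ J.toFinite).trans hJ)
    (fun I J _ hJ hIJ => by
      obtain ⟨e, heJ, heI⟩ := Set.exists_mem_notMem_of_ncard_lt_ncard hIJ
      exact ⟨e, heJ, heI, (Set.ncard_insert_le e I).trans (by omega)⟩)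
    (fun _ _ => Set.subset_univ _)).matroid

instance finite_uniformMatroid (k n : ℕ) : (uniformMatroid k n).Finite :=
  ⟨Set.toFinite _⟩

/-- The polynomial `g_{k,h} = γ_{U_{k,h+1}} - γ_{U_{k-1,h}}`, for `1 ≤ k ≤ h`. -/
noncomputable def gPoly (k h : ℕ) : ℤ[X] :=
  (uniformMatroid k (h + 1)).gamma - (uniformMatroid (k - 1) h).gamma

/-! ### The definitions have the expected defining properties -/

theorem uniformMatroid_isBase_iff {k n : ℕ} (hkn : k ≤ n) (B : Set (Fin n)) :
    (uniformMatroid k n).IsBase B ↔ B.ncard = k := by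
  have hI : ∀ I : Set (Fin n), (uniformMatroid k n).Indep I ↔ I.ncard ≤ k := fun I => Iff.rfl
  rw [Matroid.isBase_iff_maximal_indep, maximal_iff]
  simp only [hI]
  constructor
  · rintro ⟨h1, h2⟩
    by_contra hne
    have hlt : B.ncard < (Set.univ : Set (Fin n)).ncard := by
      rw [Set.ncard_univ, Nat.card_fin]; omega
    obtain ⟨e, -, he⟩ := Set.exists_mem_notMem_of_ncard_lt_ncard hlt
    have := h2 (y := insert e B) ((Set.ncard_insert_le e B).trans (by omega))
      (Set.subset_insert e B)
    exact he (this ▸ Set.mem_insert e B)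
  · rintro h
    exact ⟨h.le, fun S hS hBS => Set.eq_of_subset_of_ncard_le hBS (by omega) S.toFinite⟩

theorem gammaCoeff_eq (f : ℤ[X]) (d m : ℕ) :
    f.coeff m = ∑ i ∈ Finset.range (m + 1),
      gammaCoeff f d i * ((d - 2 * i).choose (m - i) : ℤ) := by
  rw [Finset.sum_range_succ, gammaCoeff.eq_def f d m,
    Fin.sum_univ_eq_sum_range (fun i => gammaCoeff f d i * ((d - 2 * i).choose (m - i) : ℤ)) m]
  simp

theorem coeff_X_pow_mul_one_add_X_pow (i e m : ℕ) :
    ((X : ℤ[X]) ^ i * (1 + X) ^ e).coeff m = if i ≤ m then (e.choose (m - i) : ℤ) else 0 := by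
  rw [coeff_X_pow_mul', coeff_one_add_X_pow]

theorem gammaPoly_coeff (f : ℤ[X]) (i : ℕ) : (gammaPoly f).coeff i =
    if i ≤ f.natDegree / 2 then gammaCoeff f f.natDegree i else 0 := by
  simp [gammaPoly, coeff_monomial]

/-- Every palindromic polynomial has the expansion that defines its `γ`-polynomial. -/
theorem gammaPoly_expansion (f : ℤ[X]) (hf : f.reflect f.natDegree = f) :
    f = ∑ i ∈ Finset.range (f.natDegree / 2 + 1),
      C ((gammaPoly f).coeff i) * (X ^ i * (1 + X) ^ (f.natDegree - 2 * i)) := by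
  set d := f.natDegree with hd
  set S := ∑ i ∈ Finset.range (d / 2 + 1),
      C ((gammaPoly f).coeff i) * (X ^ i * (1 + X) ^ (d - 2 * i)) with hS
  have hcS : ∀ m, S.coeff m = ∑ i ∈ Finset.range (d / 2 + 1),
      gammaCoeff f d i * if i ≤ m then ((d - 2 * i).choose (m - i) : ℤ) else 0 := by
    intro m
    rw [hS, finsetSum_coeff]
    refine Finset.sum_congr rfl fun i hi => ?_
    rw [coeff_C_mul, coeff_X_pow_mul_one_add_X_pow, gammaPoly_coeff, if_pos]
    have := Finset.mem_range.1 hi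
    omega
  have hlow : ∀ m, m ≤ d / 2 → f.coeff m = S.coeff m := by
    intro m hm
    rw [hcS, gammaCoeff_eq f d m,
      ← Finset.sum_subset (s₁ := Finset.range (m + 1)) (s₂ := Finset.range (d / 2 + 1))
      (Finset.range_subset_range.2 (by omega))]
    · refine Finset.sum_congr rfl fun i hi => ?_
      have := Finset.mem_range.1 hi
      rw [if_pos (by omega)]
    · intro i _ hi
      have : ¬ i < m + 1 := fun h => hi (Finset.mem_range.2 h)
      rw [if_neg (by omega), mul_zero]
  have hfsym : ∀ m, m ≤ d → f.coeff (d - m) = f.coeff m := by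
    intro m hm
    conv_rhs => rw [← hf, coeff_reflect, revAt_le hm]
  have hSsym : ∀ m, m ≤ d / 2 → S.coeff (d - m) = S.coeff m := by
    intro m hm
    rw [hcS, hcS]
    refine Finset.sum_congr rfl fun i hi => ?_
    have := Finset.mem_range.1 hi
    rw [if_pos (by omega)]
    split_ifs with him
    · rw [← Nat.choose_symm (n := d - 2 * i) (k := m - i) (by omega)]
      congr 3
      omega
    · rw [Nat.choose_eq_zero_of_lt (by omega)]
      simp
  ext m
  rcases le_or_gt m (d / 2) with h | h
  · exact hlow m h
  rcases le_or_gt m d with h' | h'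
  · have e : m = d - (d - m) := by omega
    rw [e, hfsym _ (by omega), hSsym _ (by omega)]
    exact hlow _ (by omega)
  · rw [coeff_eq_zero_of_natDegree_lt (hd ▸ h'), hcS]
    symm
    refine Finset.sum_eq_zero fun i hi => ?_
    have := Finset.mem_range.1 hi
    rw [if_pos (by omega), Nat.choose_eq_zero_of_lt (by omega)]
    simp

/-- The coefficients of such an expansion are those of the `γ`-polynomial. -/
theorem gammaPoly_unique (f : ℤ[X]) (c : ℕ → ℤ)
    (hc : f = ∑ i ∈ Finset.range (f.natDegree / 2 + 1),
      C (c i) * (X ^ i * (1 + X) ^ (f.natDegree - 2 * i))) :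
    ∀ i ≤ f.natDegree / 2, (gammaPoly f).coeff i = c i := by
  set d := f.natDegree with hd
  intro m
  induction m using Nat.strong_induction_on with
  | _ m ih =>
    intro hm
    have h1 := gammaCoeff_eq f d m
    have h2 : f.coeff m = ∑ i ∈ Finset.range (m + 1),
        c i * ((d - 2 * i).choose (m - i) : ℤ) := by
      rw [hc, finsetSum_coeff, ← Finset.sum_subset (s₁ := Finset.range (m + 1))
        (Finset.range_subset_range.2 (by omega))]
      · refine Finset.sum_congr rfl fun i hi => ?_
        have := Finset.mem_range.1 hi
        rw [coeff_C_mul, coeff_X_pow_mul_one_add_X_pow, if_pos (by omega)]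
      · intro i _ hi
        have : ¬ i < m + 1 := fun h => hi (Finset.mem_range.2 h)
        rw [coeff_C_mul, coeff_X_pow_mul_one_add_X_pow, if_neg (by omega), mul_zero]
    have h3 : ∀ i ∈ Finset.range m, gammaCoeff f d i * ((d - 2 * i).choose (m - i) : ℤ) =
        c i * ((d - 2 * i).choose (m - i) : ℤ) := by
      intro i hi
      have := Finset.mem_range.1 hi
      have h := ih i this (by omega)
      rw [gammaPoly_coeff, if_pos (by omega)] at h
      rw [h]
    rw [h1, Finset.sum_range_succ, Finset.sum_range_succ, Finset.sum_congr rfl h3] at h2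
    rw [gammaPoly_coeff, if_pos hm]
    simpa using h2

namespace Matroid

/-- Any assignment of polynomials with the characterizing properties of the Kazhdan--Lusztig
polynomials of matroids is the one defined above. -/
theorem klPoly_unique {α : Type*} (P : (M : Matroid α) → M.Finite → ℤ[X])
    (h_empty : ∀ (M : Matroid α) (hM : M.Finite), M.E = ∅ → P M hM = 1)
    (h_loops : ∀ (M : Matroid α) (hM : M.Finite), ¬ M.Loopless → P M hM = 0)
    (h_deg : ∀ (M : Matroid α) (hM : M.Finite), M.natRank ≠ 0 →
      2 * (P M hM).natDegree < M.natRank)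
    (h_rec : ∀ (M : Matroid α) (hM : M.Finite), M.Loopless →
      (P M hM).reflect M.natRank =
        ∑ F : M.Flats, (M.localization F).charPoly * P (M ／ F.1) inferInstance)
    (M : Matroid α) (hM : M.Finite) : P M hM = M.klPoly := by
  induction hn : M.E.ncard using Nat.strong_induction_on generalizing M with
  | _ n ih =>
  subst hn
  rw [klPoly]
  split_ifs with hE hl
  · exact h_empty M hM hE
  · have hcl : M.IsFlat ∅ := by
      have h := M.isFlat_closure ∅
      rwa [← Matroid.loops, M.loops_eq_empty] at h
    have hk : M.natRank ≠ 0 := by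
      intro h0
      have h1 : M.eRk M.E = 0 := by
        rcases ENat.toNat_eq_zero.1 h0 with h | h
        · exact h
        · exact absurd h (by rw [eRk_ground]; exact (eRank_ne_top_iff M).2 inferInstance)
      rw [eRk_eq_zero_iff, M.loops_eq_empty] at h1
      exact hE (Set.subset_empty_iff.1 h1)
    have hd := h_deg M hM hk
    have hr := h_rec M hM hl
    set b : M.Flats := ⟨∅, hcl⟩ with hb
    have hchar : (M.localization b).charPoly = 1 := by
      have hu : ∀ F : (M.localization b).Flats, F = (M.localization b).botFlat := by
        intro F
        have h : ∀ G : (M.localization b).Flats, G.1 = ∅ := fun G =>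
          Set.subset_empty_iff.1 G.2.subset_ground
        exact Subtype.ext ((h F).trans (h _).symm)
      have h0 : (M.localization b).natRank = 0 := by
        simp [natRank, natRk, localization, hb]
      rw [charPoly, Fintype.sum_eq_single (M.localization b).botFlat
        (fun F hF => absurd (hu F) hF)]
      simp [h0]
    have hcon : P (M ／ b.1) inferInstance = P M hM := by
      congr 1
      exact M.contract_empty
    have hsum : (P M hM).reflect M.natRank = P M hM + ∑ F : {F : M.Flats // F.1 ≠ ∅},
        (M.localization F.1).charPoly * (M ／ F.1.1).klPoly := by
      classical
      rw [hr, ← Finset.add_sum_erase _ _ (Finset.mem_univ b), hchar, one_mul, hcon]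
      congr 1
      rw [← Finset.sum_subtype (Finset.univ.erase b) (p := fun F : M.Flats => F.1 ≠ ∅)
        (f := fun F : M.Flats => (M.localization F).charPoly * (M ／ F.1).klPoly)]
      · refine Finset.sum_congr rfl fun F hF => ?_
        have hne : F.1 ≠ ∅ := fun h => (Finset.mem_erase.1 hF).1 (Subtype.ext h)
        rw [ih _ (M.ncard_contract_lt F hne) _ inferInstance rfl]
      · intro F
        simp [hb, Subtype.ext_iff]
    ext i
    rw [finsetSum_coeff]
    simp only [coeff_monomial]
    rw [Finset.sum_ite_eq']
    have hi := congrArg (fun p => p.coeff i) hsum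
    simp only [coeff_add, coeff_reflect] at hi
    split_ifs with h
    · have h2 := (Finset.mem_filter.1 h).2
      rw [revAt_le (by omega), coeff_eq_zero_of_natDegree_lt (by omega)] at hi
      linarith
    · refine coeff_eq_zero_of_natDegree_lt ?_
      by_contra h3
      exact h (Finset.mem_filter.2 ⟨Finset.mem_range.2 (by omega), by omega⟩)
  · exact h_loops M hM hl

end Matroid

/-! Part (a) rests on the remark that a polynomial of degree below k/2 that is palindromic of degree
k must vanish (`eq_zero_of_reflect_eq`). Palindromicity of Z (`zPoly_reflect`) goes by induction on
the ground set. Let T be the part of Z coming from flats F ≠ ⊥, and A the sum of μ(⊥,G) Z_{M/G} over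
G ≠ ⊥. Möbius inversion and the induction hypothesis show that f ↦ t^k f(1/t) exchanges A and T up
to sign, while A + T is the sum whose low coefficients, negated, define P.

In a paving matroid of rank k the flats of rank at most k-2 are exactly the sets with at most k-2
elements. Contracting such a flat F gives a paving matroid whose hyperplanes are the H \ F with H ⊇
F, and every (k-1)-set lies in exactly one hyperplane. Induction on k then gives P_M as P_{U_{k,n}}
minus a correction `relaxKL k h` for each hyperplane with h elements: the difference of the two
sides has degree below k/2, and it is palindromic because for h ≥ k the matching correction to Z,
`relaxZ k h` = Z_{U_{k,h+1}} - (1+t) Z_{U_{k-1,h}}, is palindromic of degree k. The same induction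
gives Z_M (`IsPaving.zPoly_eq`). A factor 1+t does not change the γ-polynomial, so g_{k,h} is the
γ-polynomial of `relaxZ k h`.

For part (b), put m = h-k. The coefficient of t^(l+1) in g_{k,k+m} is `gNum l m k`, a sum of
positive terms when 2l+2 ≤ k. To see this, binomial inversion at fixed m expresses `relaxKL k (k+m)`
through the polynomials `relaxZ (k-i) (k-i+m)`. As its degree is below k/2, this is a recursion in k
for the low coefficients of `relaxZ`. The candidates `pNum` satisfy the same recursion: they are
polynomials in k of degree less than k+m, so their finite difference of order k+m vanishes, and the
terms of it that lie outside the recursion are values at 0, -1, ..., -m, which are explicit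
(`eval_pNumPoly_neg`). -/

/-! ### Finite differences and the closed form for the coefficients of g. -/

/-- Alternating binomial sums of values of a polynomial of small degree vanish. -/
theorem sum_alternating_choose_eval_eq_zero {f : ℚ[X]} {n : ℕ} (hf : f.natDegree < n) (x : ℚ) :
    ∑ i ∈ Finset.range (n + 1), (-1 : ℚ) ^ i * (n.choose i : ℚ) * f.eval (x + i) = 0 := by
  have h := congrFun (Polynomial.fwdDiff_iter_eq_zero_of_degree_lt hf) x
  rw [fwdDiff_iter_eq_sum_shift] at h
  have h2 : ∑ i ∈ Finset.range (n + 1), (-1 : ℚ) ^ i * (n.choose i : ℚ) * f.eval (x + i) =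
      (-1) ^ n * ∑ k ∈ Finset.range (n + 1),
        ((-1 : ℤ) ^ (n - k) * (n.choose k : ℤ)) • f.eval (x + k • (1 : ℚ)) := by
    rw [Finset.mul_sum]
    refine Finset.sum_congr rfl fun i hi => ?_
    have hi' : i ≤ n := Nat.lt_succ_iff.1 (Finset.mem_range.1 hi)
    have e : (-1 : ℚ) ^ n * (-1) ^ (n - i) = (-1) ^ i := by
      rw [← pow_add, show n + (n - i) = i + 2 * (n - i) by omega, pow_add, pow_mul]
      simp
    rw [← e]
    simp only [zsmul_eq_mul, nsmul_eq_mul, mul_one]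
    push_cast
    ring
  rw [h2, h]
  simp

/-- The same with the polynomial evaluated in decreasing order. -/
theorem sum_alternating_choose_eval_sub_eq_zero {f : ℚ[X]} {n : ℕ} (hf : f.natDegree < n) (x : ℚ) :
    ∑ i ∈ Finset.range (n + 1), (-1 : ℚ) ^ i * (n.choose i : ℚ) * f.eval (x - i) = 0 := by
  have h := sum_alternating_choose_eval_eq_zero (f := f.comp (-X)) (n := n)
    (by rw [natDegree_comp]; simpa using hf) (-x)
  rw [← h]
  refine Finset.sum_congr rfl fun i _ => ?_
  rw [eval_comp]
  simp only [eval_neg, eval_X]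
  ring_nf

/-- The binomial coefficient `binom(x, n)` as a polynomial in `x`. -/
noncomputable def binomPoly (n : ℕ) : ℚ[X] := C ((n.factorial : ℚ)⁻¹) * descPochhammer ℚ n

theorem natDegree_binomPoly_le (n : ℕ) : (binomPoly n).natDegree ≤ n :=
  (natDegree_C_mul_le _ _).trans (descPochhammer_natDegree ℚ n).le

theorem eval_binomPoly_natCast (n N : ℕ) : (binomPoly n).eval (N : ℚ) = N.choose n := by
  rw [binomPoly, eval_C_mul, Nat.cast_choose_eq_descPochhammer_div]
  ring

theorem eval_binomPoly_neg (n N : ℕ) :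
    (binomPoly n).eval (-((N : ℚ) + 1)) = (-1) ^ n * ((N + n).choose n : ℚ) := by
  have h := ascPochhammer_eval_neg_eq_descPochhammer ℚ (-((N : ℚ) + 1)) n
  rw [neg_neg] at h
  have h2 : (descPochhammer ℚ n).eval (-((N : ℚ) + 1)) =
      (-1) ^ n * (ascPochhammer ℚ n).eval ((N : ℚ) + 1) := by
    rw [h, ← mul_assoc, ← mul_pow]; simp
  rw [binomPoly, eval_C_mul, h2, Nat.cast_choose_eq_descPochhammer_div,
    descPochhammer_eval_eq_ascPochhammer]
  push_cast
  rw [add_sub_cancel_right]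
  ring

/-- The polynomial in `m` whose value is the number
`(m+1)⋯(m+l) (m+l+3)⋯(m+2l+2) / ((l+1)! l!)`. -/
noncomputable def dissectionPoly (l : ℕ) : ℚ[X] :=
  C ((((l + 1).factorial : ℚ) * l.factorial)⁻¹) *
    ((ascPochhammer ℚ l).comp (X + 1) * (ascPochhammer ℚ l).comp (X + C ((l : ℚ) + 3)))

theorem natDegree_dissectionPoly_le (l : ℕ) : (dissectionPoly l).natDegree ≤ 2 * l := by
  refine (natDegree_C_mul_le _ _).trans (natDegree_mul_le.trans ?_)
  rw [natDegree_comp, natDegree_comp, ascPochhammer_natDegree, natDegree_X_add_C,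
    show (X + 1 : ℚ[X]) = X + C 1 by simp, natDegree_X_add_C]
  omega

theorem eval_dissectionPoly (l : ℕ) (x : ℚ) : (dissectionPoly l).eval x =
    (((l + 1).factorial : ℚ) * l.factorial)⁻¹ *
      ((ascPochhammer ℚ l).eval (x + 1) * (ascPochhammer ℚ l).eval (x + (l + 3))) := by
  simp [dissectionPoly, eval_comp]

theorem eval_dissectionPoly_pos (l m : ℕ) : 0 < (dissectionPoly l).eval (m : ℚ) := by
  rw [eval_dissectionPoly]
  have h1 := ascPochhammer_pos l ((m : ℚ) + 1) (by positivity)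
  have h2 := ascPochhammer_pos l ((m : ℚ) + (l + 3)) (by positivity)
  positivity

/-- The roots of `dissectionPoly l` are -1, ..., -l and -(l+3), ..., -(2l+2). Only the gap between
the two runs, -(l+1) and -(l+2), survives when a finite difference is taken across them. -/
theorem eval_dissectionPoly_neg_of_lt {l a : ℕ} (ha : a < l) :
    (dissectionPoly l).eval (-((a : ℚ) + 1)) = 0 := by
  rw [eval_dissectionPoly, show -((a : ℚ) + 1) + 1 = -(a : ℚ) by ring,
    ascPochhammer_eval_neg_coe_nat_of_lt ha]
  ring

theorem eval_dissectionPoly_neg_of_lt' {l a : ℕ} (ha : a < l) :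
    (dissectionPoly l).eval (-((a : ℚ) + (l + 3))) = 0 := by
  rw [eval_dissectionPoly, show -((a : ℚ) + (l + 3)) + (l + 3) = -(a : ℚ) by ring,
    ascPochhammer_eval_neg_coe_nat_of_lt ha]
  ring

theorem eval_dissectionPoly_neg_add_one (l : ℕ) :
    (dissectionPoly l).eval (-((l : ℚ) + 1)) = (-1) ^ l := by
  have h1 : (ascPochhammer ℚ l).eval (-(l : ℚ)) = (-1) ^ l * l.factorial := by
    rw [ascPochhammer_eval_neg_eq_descPochhammer, descPochhammer_eval_eq_descFactorial,
      Nat.descFactorial_self]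
  have h2 : (ascPochhammer ℚ l).eval (2 : ℚ) = (l + 1).factorial := by
    have := factorial_mul_ascPochhammer ℚ 1 l
    norm_num at this
    rw [this, add_comm]
  rw [eval_dissectionPoly, show -((l : ℚ) + 1) + 1 = -(l : ℚ) by ring,
    show -((l : ℚ) + 1) + (l + 3) = 2 by ring, h1, h2]
  field_simp

theorem eval_dissectionPoly_neg_add_two (l : ℕ) :
    (dissectionPoly l).eval (-((l : ℚ) + 2)) = (-1) ^ l := by
  have h1 : (ascPochhammer ℚ l).eval (-((l : ℚ) + 1)) = (-1) ^ l * (l + 1).factorial := by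
    rw [ascPochhammer_eval_neg_eq_descPochhammer, ← Nat.cast_add_one,
      descPochhammer_eval_eq_descFactorial,
      ← Nat.factorial_mul_descFactorial (Nat.le_succ l)]
    simp
  rw [eval_dissectionPoly, show -((l : ℚ) + 2) + 1 = -((l : ℚ) + 1) by ring,
    show -((l : ℚ) + 2) + (l + 3) = 1 by ring, h1, ascPochhammer_eval_one]
  field_simp

/-- The polynomial has degree at most 2l, so its difference of order r+2l+1 over the points -(2l+1),
..., r is zero. The points 0, ..., r give minus the left side. Among the negative points only -(l+1)
and -(l+2) count, leaving binom(r+2l+1, l) - binom(r+2l+1, l-1). -/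
theorem sum_alternating_dissection (l r : ℕ) :
    ∑ m ∈ Finset.range (r + 1), (-1 : ℚ) ^ m * (dissectionPoly l).eval (m : ℚ) *
        ((r + 2 * l + 1).choose (r - m) : ℚ) =
      (r + 2) * (r + 2 * l + 1).factorial / (l.factorial * (r + l + 2).factorial) := by
  have h := sum_alternating_choose_eval_eq_zero (f := dissectionPoly l) (n := r + 2 * l + 1)
    ((natDegree_dissectionPoly_le l).trans_lt (by omega)) (-(2 * l + 1))
  rw [show r + 2 * l + 1 + 1 = (2 * l + 1) + (r + 1) by ring, Finset.sum_range_add] at h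
  have h1 : ∑ m ∈ Finset.range (r + 1), (-1 : ℚ) ^ (2 * l + 1 + m) *
      ((r + 2 * l + 1).choose (2 * l + 1 + m) : ℚ) *
        (dissectionPoly l).eval (-(2 * l + 1) + ((2 * l + 1 + m : ℕ) : ℚ)) =
      - ∑ m ∈ Finset.range (r + 1), (-1 : ℚ) ^ m * (dissectionPoly l).eval (m : ℚ) *
        ((r + 2 * l + 1).choose (r - m) : ℚ) := by
    rw [← Finset.sum_neg_distrib]
    refine Finset.sum_congr rfl fun m hm => ?_
    have hm' := Finset.mem_range.1 hm
    rw [← Nat.choose_symm_of_eq_add (n := r + 2 * l + 1) (a := 2 * l + 1 + m) (b := r - m)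
      (by omega), show -(2 * (l : ℚ) + 1) + ((2 * l + 1 + m : ℕ) : ℚ) = m by push_cast; ring,
      pow_add, pow_succ, pow_mul]
    norm_num
    ring
  have h2 : ∑ y ∈ Finset.range (2 * l + 1), (-1 : ℚ) ^ y *
      ((r + 2 * l + 1).choose y : ℚ) * (dissectionPoly l).eval (-(2 * l + 1) + (y : ℚ)) =
      (r + 2) * (r + 2 * l + 1).factorial / (l.factorial * (r + l + 2).factorial) := by
    rw [show 2 * l + 1 = (l + 1) + l by ring, Finset.sum_range_add, Finset.sum_range_succ]
    have z1 : ∑ x ∈ Finset.range l, (-1 : ℚ) ^ (l + 1 + x) *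
        ((r + 2 * l + 1).choose (l + 1 + x) : ℚ) *
          (dissectionPoly l).eval (-(2 * l + 1) + ((l + 1 + x : ℕ) : ℚ)) = 0 := by
      refine Finset.sum_eq_zero fun x hx => ?_
      have hx := Finset.mem_range.1 hx
      have e : -(2 * (l : ℚ) + 1) + ((l + 1 + x : ℕ) : ℚ) = -(((l - 1 - x : ℕ) : ℚ) + 1) := by
        rw [show ((l - 1 - x : ℕ) : ℚ) = l - 1 - x by
          rw [Nat.sub_sub, Nat.cast_sub (by omega)]; push_cast; ring]
        push_cast; ring
      rw [e, eval_dissectionPoly_neg_of_lt (by omega), mul_zero]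
    rw [z1, add_zero,
      show -(2 * (l : ℚ) + 1) + l = -(l + 1) by ring, eval_dissectionPoly_neg_add_one]
    -- For l = 0 the range starts at -1, so the point -(l+2) is not in it.
    rcases l with _ | l
    · simp only [Finset.range_zero, Finset.sum_empty]
      simp [Nat.factorial_succ]
      field_simp
      ring
    · rw [Finset.sum_range_succ, Finset.sum_eq_zero, zero_add]
      · have e : -(2 * ((l + 1 : ℕ) : ℚ) + 1) + l = -(((l + 1 : ℕ) : ℚ) + 2) := by push_cast; ring
        rw [e, eval_dissectionPoly_neg_add_two]
        have f1 : ((r + 2 * (l + 1) + 1).choose l : ℚ) =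
            (r + 2 * (l + 1) + 1).factorial / (l.factorial * (r + l + 3).factorial) := by
          rw [Nat.cast_choose ℚ (by omega), show r + 2 * (l + 1) + 1 - l = r + l + 3 by omega]
        have f2 : ((r + 2 * (l + 1) + 1).choose (l + 1) : ℚ) =
            (r + 2 * (l + 1) + 1).factorial / ((l + 1).factorial * (r + l + 2).factorial) := by
          rw [Nat.cast_choose ℚ (by omega),
            show r + 2 * (l + 1) + 1 - (l + 1) = r + l + 2 by omega]
        have s1 : (-1 : ℚ) ^ (l + 1) * (-1) ^ (l + 1) = 1 := by
          rw [← mul_pow]; simp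
        have s2 : (-1 : ℚ) ^ l * (-1) ^ (l + 1) = -1 := by
          rw [pow_succ, ← mul_assoc, ← mul_pow]; simp
        rw [f1, f2, mul_right_comm, s2, mul_right_comm, s1,
          show r + (l + 1) + 2 = (r + l + 2) + 1 by ring, show r + l + 3 = (r + l + 2) + 1 by ring,
          Nat.factorial_succ (r + l + 2), Nat.factorial_succ l]
        push_cast
        field_simp
        ring
      · intro x hx
        have hx := Finset.mem_range.1 hx
        have e : -(2 * ((l + 1 : ℕ) : ℚ) + 1) + (x : ℚ) =
            -(((l - 1 - x : ℕ) : ℚ) + (((l + 1 : ℕ) : ℚ) + 3)) := by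
          rw [show ((l - 1 - x : ℕ) : ℚ) = l - 1 - x by
            rw [Nat.sub_sub, Nat.cast_sub (by omega)]; push_cast; ring]
          push_cast; ring
        rw [e, eval_dissectionPoly_neg_of_lt' (by omega), mul_zero]
  rw [h1, h2] at h
  linarith

/-- The rational number that turns out to be the coefficient of `t ^ (l + 1)` in `g_{k, k + m}`. -/
noncomputable def gNum (l m k : ℕ) : ℚ :=
  ∑ i ∈ Finset.range (m + 1),
    ((i + k - 1).choose (i + 2 * l + 1) : ℚ) * (dissectionPoly l).eval (i : ℚ)

theorem gNum_nonneg (l m k : ℕ) : 0 ≤ gNum l m k :=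
  Finset.sum_nonneg fun i _ => mul_nonneg (by positivity) (eval_dissectionPoly_pos l i).le

theorem gNum_pos {l k : ℕ} (m : ℕ) (hk : 2 * l + 2 ≤ k) : 0 < gNum l m k :=
  Finset.sum_pos (fun i _ => mul_pos
    (by exact_mod_cast Nat.choose_pos (by omega)) (eval_dissectionPoly_pos l i)) (by simp)

theorem gNum_eq_zero {l k : ℕ} (m : ℕ) (hk : 1 ≤ k) (hkl : k < 2 * l + 2) : gNum l m k = 0 :=
  Finset.sum_eq_zero fun i _ => by rw [Nat.choose_eq_zero_of_lt (by omega)]; simp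

/-- `gNum l m k` as a polynomial in `k`. -/
noncomputable def gNumPoly (l m : ℕ) : ℚ[X] :=
  ∑ i ∈ Finset.range (m + 1), C ((dissectionPoly l).eval (i : ℚ)) *
    (binomPoly (i + 2 * l + 1)).comp (X + C ((i : ℚ) - 1))

theorem natDegree_gNumPoly_le (l m : ℕ) : (gNumPoly l m).natDegree ≤ m + 2 * l + 1 := by
  refine natDegree_sum_le_of_forall_le _ _ fun i hi => (natDegree_C_mul_le _ _).trans ?_
  have := Finset.mem_range.1 hi
  rw [natDegree_comp, natDegree_X_add_C, mul_one]
  exact (natDegree_binomPoly_le _).trans (by omega)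

theorem eval_gNumPoly (l m : ℕ) (x : ℚ) : (gNumPoly l m).eval x =
    ∑ i ∈ Finset.range (m + 1), (dissectionPoly l).eval (i : ℚ) *
      (binomPoly (i + 2 * l + 1)).eval (x + (i - 1)) := by
  simp [gNumPoly, eval_finsetSum, eval_comp]

theorem eval_gNumPoly_natCast {l m k : ℕ} (hk : 1 ≤ k) :
    (gNumPoly l m).eval (k : ℚ) = gNum l m k := by
  rw [eval_gNumPoly, gNum]
  refine Finset.sum_congr rfl fun i _ => ?_
  rw [show (k : ℚ) + (i - 1) = ((i + k - 1 : ℕ) : ℚ) by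
    rw [Nat.cast_sub (by omega)]; push_cast; ring, eval_binomPoly_natCast, mul_comm]

/-- At -r the summands with i > r vanish, being binom(N, j) with 0 ≤ N < j. Those with i ≤ r become,
by binomial reciprocity, the sum of `sum_alternating_dissection`. In particular the value does not
depend on m. -/
theorem eval_gNumPoly_neg {l m r : ℕ} (hr : r ≤ m) : (gNumPoly l m).eval (-(r : ℚ)) =
    -((r + 2) * (r + 2 * l + 1).factorial / (l.factorial * (r + l + 2).factorial)) := by
  rw [← sum_alternating_dissection, eval_gNumPoly, ← Finset.sum_neg_distrib,
    ← Finset.sum_subset (Finset.range_subset_range.2 (Nat.succ_le_succ hr))]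
  · refine Finset.sum_congr rfl fun i hi => ?_
    have hi := Finset.mem_range.1 hi
    rw [show -(r : ℚ) + (i - 1) = -(((r - i : ℕ) : ℚ) + 1) by
      rw [Nat.cast_sub (by omega)]; ring, eval_binomPoly_neg,
      show r - i + (i + 2 * l + 1) = r + 2 * l + 1 by omega,
      Nat.choose_symm_of_eq_add (n := r + 2 * l + 1) (a := i + 2 * l + 1) (b := r - i) (by omega),
      show i + 2 * l + 1 = i + 1 + 2 * l by ring, pow_add, pow_mul, pow_succ]
    norm_num
    ring
  · intro i _ hi
    have hi : r + 1 ≤ i := by simpa using hi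
    rw [show -(r : ℚ) + (i - 1) = ((i - (r + 1) : ℕ) : ℚ) by
      rw [Nat.cast_sub hi]; push_cast; ring, eval_binomPoly_natCast,
      Nat.choose_eq_zero_of_lt (by omega)]
    simp

/-- The coefficient of `t ^ b` in `∑ l, gNum l m k t ^ (l + 1) (1 + t) ^ (k - 2 (l + 1))`. -/
noncomputable def pNum (m k b : ℕ) : ℚ :=
  ∑ l ∈ Finset.range b, gNum l m k * ((k - (2 * l + 2)).choose (b - 1 - l) : ℚ)

/-- `pNum m k (c + 1)` as a polynomial in `k`. -/
noncomputable def pNumPoly (m c : ℕ) : ℚ[X] :=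
  ∑ l ∈ Finset.range (c + 1), gNumPoly l m * (binomPoly (c - l)).comp (X - C (2 * (l : ℚ) + 2))

theorem natDegree_pNumPoly_le (m c : ℕ) : (pNumPoly m c).natDegree ≤ m + 2 * c + 1 := by
  refine natDegree_sum_le_of_forall_le _ _ fun l hl => natDegree_mul_le.trans ?_
  have h1 := natDegree_gNumPoly_le l m
  have h2 := natDegree_binomPoly_le (c - l)
  have := Finset.mem_range.1 hl
  rw [natDegree_comp, natDegree_X_sub_C, mul_one]
  omega

theorem eval_pNumPoly (m c : ℕ) (x : ℚ) : (pNumPoly m c).eval x =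
    ∑ l ∈ Finset.range (c + 1),
      (gNumPoly l m).eval x * (binomPoly (c - l)).eval (x - (2 * l + 2)) := by
  simp [pNumPoly, eval_finsetSum, eval_comp]

theorem eval_pNumPoly_natCast {m c k : ℕ} (hk : 1 ≤ k) :
    (pNumPoly m c).eval (k : ℚ) = pNum m k (c + 1) := by
  rw [eval_pNumPoly, pNum]
  refine Finset.sum_congr rfl fun l _ => ?_
  rw [eval_gNumPoly_natCast hk]
  -- For k < 2l+2 the truncated k - (2l+2) differs from the argument of the polynomial, but there
  -- the factor `gNum` is zero.
  rcases lt_or_ge k (2 * l + 2) with h | h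
  · rw [gNum_eq_zero m hk h]; simp
  · rw [show (k : ℚ) - (2 * l + 2) = ((k - (2 * l + 2) : ℕ) : ℚ) by
      rw [Nat.cast_sub h]; push_cast; ring, eval_binomPoly_natCast, Nat.add_sub_cancel]

/-- After cancelling (r+2l+1)! the summand is (-1)^l binom(c, l) times a quotient of factorials. For
c ≥ 1 that quotient is a polynomial in l of degree c-1, so the difference of order c kills it. For c
= 0 it is 1/(r+2). -/
theorem eval_pNumPoly_neg {m r : ℕ} (c : ℕ) (hr : r ≤ m) :
    (pNumPoly m c).eval (-(r : ℚ)) = if c = 0 then -1 else 0 := by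
  have key : (pNumPoly m c).eval (-(r : ℚ)) = -((r + 2) * (-1) ^ c / c.factorial) *
      ∑ l ∈ Finset.range (c + 1), (-1 : ℚ) ^ l * (c.choose l : ℚ) *
        (((r + c + l + 1).factorial : ℚ) / (r + l + 2).factorial) := by
    rw [eval_pNumPoly, Finset.mul_sum]
    refine Finset.sum_congr rfl fun l hl => ?_
    have hl := Finset.mem_range.1 hl
    rw [eval_gNumPoly_neg hr, show -(r : ℚ) - (2 * l + 2) = -(((r + 2 * l + 1 : ℕ) : ℚ) + 1) by
      push_cast; ring, eval_binomPoly_neg,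
      show r + 2 * l + 1 + (c - l) = r + c + l + 1 by omega, Nat.cast_choose ℚ (by omega),
      show r + c + l + 1 - (c - l) = r + 2 * l + 1 by omega, Nat.cast_choose ℚ (by omega : l ≤ c)]
    have e : (-1 : ℚ) ^ (c - l) = (-1) ^ c * (-1) ^ l := by
      rw [← pow_add, show c + l = (c - l) + 2 * l by omega, pow_add, pow_mul]; simp
    rw [e]
    field_simp
  rw [key]
  rcases c with _ | c
  · simp [Nat.factorial_succ]
    field_simp
    ring
  · have h := sum_alternating_choose_eval_eq_zero (n := c + 1) (f := ascPochhammer ℚ c)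
      (by rw [ascPochhammer_natDegree]; omega) ((r : ℚ) + 3)
    have e : ∀ l : ℕ, ((r + (c + 1) + l + 1).factorial : ℚ) / (r + l + 2).factorial =
        (ascPochhammer ℚ c).eval ((r : ℚ) + 3 + l) := by
      intro l
      have := factorial_mul_ascPochhammer ℚ (r + l + 2) c
      rw [div_eq_iff (by positivity), show r + (c + 1) + l + 1 = r + l + 2 + c by ring, ← this,
        mul_comm]
      congr 2
      push_cast
      ring
    simp only [e]
    rw [h]
    simp

/-- This is the recursion that also holds for the coefficients of `relaxZ`; see
`sum_alternating_choose_mul_relaxZ_coeff`. The bound 2b ≤ k is what keeps the degree of `pNumPoly`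
below k+m. -/
theorem sum_alternating_choose_mul_pNum {m k b : ℕ} (hk : 2 ≤ k) (hb : 2 * b ≤ k) :
    ∑ i ∈ Finset.range k, (-1 : ℚ) ^ i * ((k + m).choose i : ℚ) * pNum m (k - i) b =
      if b = 1 then (-1) ^ k * ((k + m - 1).choose (k - 1) : ℚ) else 0 := by
  rcases b with _ | c
  · simp [pNum]
  have h := sum_alternating_choose_eval_sub_eq_zero (n := k + m) (f := pNumPoly m c)
    ((natDegree_pNumPoly_le m c).trans_lt (by omega)) k
  -- The terms i < k are the wanted sum. The other m+1 terms evaluate the polynomial at 0, -1, ...,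
  -- -m.
  rw [show k + m + 1 = k + (m + 1) by ring, Finset.sum_range_add] at h
  have h1 : ∑ i ∈ Finset.range k, (-1 : ℚ) ^ i * ((k + m).choose i : ℚ) *
      (pNumPoly m c).eval ((k : ℚ) - i) =
      ∑ i ∈ Finset.range k, (-1 : ℚ) ^ i * ((k + m).choose i : ℚ) * pNum m (k - i) (c + 1) := by
    refine Finset.sum_congr rfl fun i hi => ?_
    have hi := Finset.mem_range.1 hi
    rw [← Nat.cast_sub hi.le, eval_pNumPoly_natCast (by omega)]
  have h2 : ∑ i ∈ Finset.range (m + 1), (-1 : ℚ) ^ (k + i) * ((k + m).choose (k + i) : ℚ) *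
      (pNumPoly m c).eval ((k : ℚ) - (k + i : ℕ)) =
      (∑ i ∈ Finset.range (m + 1), (-1 : ℚ) ^ (k + i) * ((k + m).choose (k + i) : ℚ)) *
        if c = 0 then -1 else 0 := by
    rw [Finset.sum_mul]
    refine Finset.sum_congr rfl fun i hi => ?_
    have hi := Finset.mem_range.1 hi
    rw [show (k : ℚ) - (k + i : ℕ) = -(i : ℚ) by push_cast; ring,
      eval_pNumPoly_neg c (by omega)]
  have h3 : ∑ i ∈ Finset.range (m + 1), (-1 : ℚ) ^ (k + i) * ((k + m).choose (k + i) : ℚ) =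
      (-1) ^ k * ((k + m - 1).choose (k - 1) : ℚ) := by
    obtain ⟨k, rfl⟩ : ∃ k', k = k' + 1 := ⟨k - 1, by omega⟩
    have a1 := Int.alternating_sum_range_choose_of_ne (n := k + 1 + m) (by omega)
    have a2 := Int.alternating_sum_range_choose_eq_choose (n := k + m) (m := k)
    rw [show k + m + 1 = k + 1 + m by ring] at a2
    rw [show k + 1 + m + 1 = (k + 1) + (m + 1) by ring, Finset.sum_range_add, a2] at a1
    have a3 : ((∑ i ∈ Finset.range (m + 1), (-1 : ℤ) ^ (k + 1 + i) *
        ((k + 1 + m).choose (k + 1 + i) : ℤ) : ℤ) : ℚ) =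
        (((-1) ^ (k + 1) * ((k + m).choose k : ℤ) : ℤ) : ℚ) := by
      congr 1
      rw [pow_succ]
      linarith
    push_cast at a3
    rw [a3, show k + 1 + m - 1 = k + m by omega, Nat.add_sub_cancel]
  rw [h1, h2, h3] at h
  rw [eq_neg_of_add_eq_zero_left h]
  split_ifs <;> simp_all

/-! ### Möbius function and flats of restrictions and contractions. -/

namespace IncidenceAlgebra

/-- The Möbius function is compatible with order embeddings onto lower sets. -/
theorem mu_orderEmbedding {P Q : Type*} [PartialOrder P] [PartialOrder Q] [LocallyFiniteOrder P]
    [LocallyFiniteOrder Q] [DecidableEq P] [DecidableEq Q] (f : P ↪o Q)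
    (hf : ∀ p q, q ≤ f p → ∃ p', f p' = q) (a b : P) :
    mu ℤ (f a) (f b) = mu ℤ a b := by
  induction hn : (Finset.Ico a b).card using Nat.strong_induction_on generalizing b with
  | _ n ih =>
  rw [mu_apply, mu_apply (a := a)]
  by_cases hab : a = b
  · simp [hab]
  rw [if_neg hab, if_neg (fun h => hab (f.injective h))]
  have himg : Finset.Ico (f a) (f b) = (Finset.Ico a b).map f.toEmbedding := by
    ext q
    simp only [Finset.mem_Ico, Finset.mem_map, RelEmbedding.coe_toEmbedding]
    constructor
    · rintro ⟨h1, h2⟩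
      obtain ⟨p, rfl⟩ := hf b q h2.le
      exact ⟨p, ⟨f.le_iff_le.1 h1, f.lt_iff_lt.1 h2⟩, rfl⟩
    · rintro ⟨p, ⟨h1, h2⟩, rfl⟩
      exact ⟨f.le_iff_le.2 h1, f.lt_iff_lt.2 h2⟩
  rw [himg, Finset.sum_map]
  congr 1
  refine Finset.sum_congr rfl fun x hx => ?_
  have hx := Finset.mem_Ico.1 hx
  refine ih _ ?_ x rfl
  rw [← hn]
  refine Finset.card_lt_card ⟨Finset.Ico_subset_Ico_right hx.2.le, fun h => ?_⟩
  exact (Finset.mem_Ico.1 (h (Finset.mem_Ico.2 hx))).2.ne rfl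

end IncidenceAlgebra

namespace Matroid

variable {α : Type*}

theorem cast_natRk (M : Matroid α) [M.RankFinite] (X : Set α) : (M.natRk X : ℕ∞) = M.eRk X :=
  ENat.natCast_toNat (ne_top_of_le_ne_top ((M.eRank_ne_top_iff).2 inferInstance) (M.eRk_le_eRank X))

theorem natRank_eq (M : Matroid α) : M.natRank = M.eRank.toNat := by
  rw [natRank, natRk, eRk_ground]

theorem natRk_mono (M : Matroid α) [M.RankFinite] {X Y : Set α} (h : X ⊆ Y) :
    M.natRk X ≤ M.natRk Y := by
  have := M.eRk_mono h
  rw [← cast_natRk, ← cast_natRk] at this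
  exact_mod_cast this

/-- The rank function is strictly increasing on flats. -/
theorem IsFlat.natRk_lt {M : Matroid α} [M.RankFinite] {F X : Set α} (hF : M.IsFlat F)
    (h : F ⊂ X) (hX : X ⊆ M.E) : M.natRk F < M.natRk X := by
  obtain ⟨e, heX, heF⟩ := Set.exists_of_ssubset h
  have h1 := M.eRk_insert_eq_add_one (e := e) (X := F) ⟨hX heX, by rwa [hF.closure]⟩
  have h2 := M.natRk_mono (Set.insert_subset heX h.subset)
  rw [← cast_natRk, ← cast_natRk] at h1
  have h3 : M.natRk (insert e F) = M.natRk F + 1 := by exact_mod_cast h1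
  omega

/-- A basis of K extends to a basis of X ∪ K, and the added elements form a basis of X in the
contraction. -/
theorem eRk_contract_add (M : Matroid α) (K X : Set α) :
    (M ／ K).eRk X + M.eRk K = M.eRk (X ∪ K) := by
  obtain ⟨I, hI⟩ := M.exists_isBasis' K
  obtain ⟨J, hJ, hIJ⟩ := hI.indep.subset_isBasis'_of_subset
    (hI.subset.trans (Set.subset_union_right (s := X)))
  have hJK : J ∩ K = I := (hI.eq_of_subset_indep (hJ.indep.inter_right K)
    (Set.subset_inter hIJ hI.subset) Set.inter_subset_right).symm
  have hB := hJ.contract_isBasis' hI (hJ.indep.subset (Set.union_subset Set.sdiff_subset hIJ))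
  have h1 : (M ／ K).eRk X = (J \ K).encard := by
    rw [hB.encard_eq_eRk, ← eRk_inter_ground, ← eRk_inter_ground _ ((X ∪ K) \ K)]
    congr 1
    rw [contract_ground]
    tauto_set
  rw [h1, ← hI.encard_eq_eRk, ← hJ.encard_eq_eRk, ← hJK, Set.encard_sdiff_add_encard_inter]

theorem natRk_contract_add (M : Matroid α) [M.Finite] (K X : Set α) :
    (M ／ K).natRk X + M.natRk K = M.natRk (X ∪ K) := by
  have := M.eRk_contract_add K X
  rw [← cast_natRk, ← cast_natRk, ← cast_natRk] at this
  exact_mod_cast this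

theorem natRank_contract_add (M : Matroid α) [M.Finite] {K : Set α} (hK : K ⊆ M.E) :
    (M ／ K).natRank + M.natRk K = M.natRank := by
  rw [natRank, natRk_contract_add, contract_ground, Set.sdiff_union_of_subset hK, natRank]

theorem isFlat_contract_iff {M : Matroid α} {F G : Set α} (hF : F ⊆ M.E) :
    (M ／ F).IsFlat G ↔ M.IsFlat (G ∪ F) ∧ Disjoint G F := by
  rw [isFlat_iff_closure_eq, isFlat_iff_closure_eq, contract_closure_eq]
  constructor
  · intro h
    have hd : Disjoint G F := by rw [← h]; exact Set.disjoint_sdiff_left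
    refine ⟨?_, hd⟩
    conv_rhs => rw [← h]
    rw [Set.sdiff_union_of_subset]
    exact (M.subset_closure F).trans (M.closure_subset_closure Set.subset_union_right)
  · rintro ⟨h1, h2⟩
    rw [h1, Set.union_sdiff_right, h2.sdiff_eq_left]

theorem isFlat_restrict_iff {M : Matroid α} {F G : Set α} (hF : M.IsFlat F) :
    (M ↾ F).IsFlat G ↔ M.IsFlat G ∧ G ⊆ F := by
  constructor
  · intro h
    have hGF : G ⊆ F := h.subset_ground
    refine ⟨?_, hGF⟩
    have h1 := h.closure
    rw [restrict_closure_eq _ hGF hF.subset_ground, Set.inter_eq_left.2] at h1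
    · exact isFlat_iff_closure_eq.2 h1
    · rw [← hF.closure]
      exact M.closure_subset_closure hGF
  · rintro ⟨h1, h2⟩
    rw [isFlat_iff_closure_eq, restrict_closure_eq _ h2 hF.subset_ground, h1.closure,
      Set.inter_eq_left.2 h2]

theorem klPoly_congr {M N : Matroid α} [M.Finite] [N.Finite] (h : M = N) :
    M.klPoly = N.klPoly := by
  subst h; rfl

open Classical in
/-- Sums over the flats of a contraction as sums over an upper interval of flats. -/
theorem sum_flats_contract {A : Type*} [AddCommMonoid A] (M : Matroid α) [M.Finite] (F : M.Flats)
    (f : Set α → A) : ∑ G : (M ／ F.1).Flats, f (G.1 ∪ F.1) =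
      ∑ H ∈ Finset.univ.filter (F ≤ ·), f H.1 := by
  refine Finset.sum_bij (fun G _ => ⟨G.1 ∪ F.1,
    ((isFlat_contract_iff F.2.subset_ground).1 G.2).1⟩) ?_ ?_ ?_ ?_
  · intro G _
    simp only [Finset.mem_filter, Finset.mem_univ, true_and]
    exact Set.subset_union_right
  · intro G _hG G' _hG' h
    have h1 := ((isFlat_contract_iff F.2.subset_ground).1 G.2).2
    have h2 := ((isFlat_contract_iff F.2.subset_ground).1 G'.2).2
    have h := congrArg (fun K => K.1 \ F.1) h
    simp only [Set.union_sdiff_right, h1.sdiff_eq_left, h2.sdiff_eq_left] at h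
    exact Subtype.ext h
  · intro H hH
    have hFH : F.1 ⊆ H.1 := (Finset.mem_filter.1 hH).2
    refine ⟨⟨H.1 \ F.1, (isFlat_contract_iff F.2.subset_ground).2
      ⟨?_, Set.disjoint_sdiff_left⟩⟩, Finset.mem_univ _, ?_⟩
    · rw [Set.sdiff_union_of_subset hFH]; exact H.2
    · exact Subtype.ext (Set.sdiff_union_of_subset hFH)
  · intro G _
    rfl

open Classical in
theorem zPoly_contract (M : Matroid α) [M.Finite] (F : M.Flats) :
    (M ／ F.1).zPoly = ∑ H ∈ Finset.univ.filter (F ≤ ·),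
      X ^ (M.natRk H.1 - M.natRk F.1) * (M ／ H.1).klPoly := by
  rw [← M.sum_flats_contract F
    (fun H => X ^ (M.natRk H - M.natRk F.1) * (M ／ H).klPoly), zPoly]
  refine Finset.sum_congr rfl fun G _ => ?_
  rw [← natRk_contract_add, Nat.add_sub_cancel]
  congr 1
  exact klPoly_congr (by rw [contract_contract, Set.union_comm])

/-- The flats of the localization at `F` are the flats contained in `F`. -/
def flatsLocalization (M : Matroid α) (F : M.Flats) : (M.localization F).Flats ↪o M.Flats where
  toFun G := ⟨G.1, ((isFlat_restrict_iff F.2).1 G.2).1⟩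
  inj' _ _ h := Subtype.ext (congrArg (fun K => K.1) h)
  map_rel_iff' := Iff.rfl

theorem exists_flatsLocalization_eq (M : Matroid α) {F H : M.Flats} (h : H ≤ F) :
    ∃ G, M.flatsLocalization F G = H :=
  ⟨⟨H.1, (isFlat_restrict_iff F.2).2 ⟨H.2, h⟩⟩, rfl⟩

theorem flatsLocalization_le (M : Matroid α) (F : M.Flats) (G : (M.localization F).Flats) :
    M.flatsLocalization F G ≤ F := ((isFlat_restrict_iff F.2).1 G.2).2

theorem flatsLocalization_botFlat (M : Matroid α) (F : M.Flats) :
    M.flatsLocalization F (M.localization F).botFlat = M.botFlat := by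
  refine Subtype.ext ?_
  change (M ↾ F.1).closure ∅ = M.closure ∅
  rw [restrict_closure_eq _ (Set.empty_subset _) F.2.subset_ground, Set.inter_eq_left]
  exact F.2.loops_subset

open Classical in
theorem charPoly_localization (M : Matroid α) [M.Finite] (F : M.Flats) :
    (M.localization F).charPoly = ∑ G ∈ Finset.univ.filter (· ≤ F),
      C (IncidenceAlgebra.mu ℤ M.botFlat G) * X ^ (M.natRk F.1 - M.natRk G.1) := by
  rw [charPoly]
  refine Finset.sum_bij (fun G _ => M.flatsLocalization F G) ?_ ?_ ?_ ?_
  · intro G _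
    exact Finset.mem_filter.2 ⟨Finset.mem_univ _, M.flatsLocalization_le F G⟩
  · intro _ _ _ _ h
    exact (M.flatsLocalization F).injective h
  · intro H hH
    obtain ⟨G, hG⟩ := M.exists_flatsLocalization_eq (Finset.mem_filter.1 hH).2
    exact ⟨G, Finset.mem_univ _, hG⟩
  · intro G _
    have hr : ∀ Y ⊆ F.1, (M.localization F).natRk Y = M.natRk Y := fun Y hY => by
      rw [natRk, natRk, localization, restrict_eRk_eq _ hY]
    rw [← flatsLocalization_botFlat M F, IncidenceAlgebra.mu_orderEmbedding _
      (fun p q hq => M.exists_flatsLocalization_eq (hq.trans (M.flatsLocalization_le F p))),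
      hr G.1 (M.flatsLocalization_le F G), natRank,
      show (M.localization F).E = F.1 from rfl, hr _ subset_rfl]
    rfl

end Matroid

/-! ### Palindromicity of the Z-polynomial. -/

theorem Polynomial.reflect_add_eq_X_pow_mul (f : ℤ[X]) {m n : ℕ} (hf : f.natDegree ≤ n) :
    f.reflect (m + n) = X ^ m * f.reflect n := by
  have h := reflect_mul (1 : ℤ[X]) f (F := m) (G := n) (by simp) hf
  rwa [one_mul, reflect_one] at h

theorem Polynomial.reflect_sum {ι : Type*} (s : Finset ι) (f : ι → ℤ[X]) (n : ℕ) :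
    (∑ i ∈ s, f i).reflect n = ∑ i ∈ s, (f i).reflect n := by
  classical
  induction s using Finset.induction_on with
  | empty => simp
  | insert a s ha ih => rw [Finset.sum_insert ha, Finset.sum_insert ha, reflect_add, ih]

namespace Matroid

variable {α : Type*}

theorem botFlat_val (M : Matroid α) [M.Loopless] : M.botFlat.1 = ∅ := M.loops_eq_empty

theorem botFlat_le (M : Matroid α) (F : M.Flats) : M.botFlat ≤ F := F.2.loops_subset

theorem natRk_botFlat (M : Matroid α) : M.natRk M.botFlat.1 = 0 := by
  rw [natRk, botFlat, eRk_closure_eq]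
  simp

theorem klPoly_of_ground_eq_empty {M : Matroid α} [M.Finite] (h : M.E = ∅) : M.klPoly = 1 := by
  rw [klPoly, if_pos h]

theorem klPoly_coeff_eq_zero (M : Matroid α) [M.Finite] {i : ℕ} (hi : i ≠ 0)
    (h : M.natRank ≤ 2 * i) : M.klPoly.coeff i = 0 := by
  rw [klPoly]
  split_ifs
  · rw [coeff_one, if_neg hi]
  · rw [finsetSum_coeff]
    refine Finset.sum_eq_zero fun j hj => ?_
    rw [coeff_monomial, if_neg]
    rintro rfl
    have := (Finset.mem_filter.1 hj).2
    omega
  · simp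

open Classical in
theorem klPoly_coeff (M : Matroid α) [M.Finite] [M.Loopless] (hE : M.E ≠ ∅) {i : ℕ}
    (h : 2 * i < M.natRank) : M.klPoly.coeff i = -(∑ F ∈ Finset.univ.erase M.botFlat,
      (M.localization F).charPoly * (M ／ F.1).klPoly).coeff i := by
  rw [klPoly, if_neg hE, if_pos ‹M.Loopless›, finsetSum_coeff]
  simp only [coeff_monomial]
  have hi : i ∈ (Finset.range M.natRank).filter (fun i => 2 * i < M.natRank) :=
    Finset.mem_filter.2 ⟨Finset.mem_range.2 (by omega), h⟩
  rw [Finset.sum_ite_eq', if_pos hi,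
    ← Finset.sum_subtype (Finset.univ.erase M.botFlat) (p := fun F : M.Flats => F.1 ≠ ∅)
      (f := fun F : M.Flats => (M.localization F).charPoly * (M ／ F.1).klPoly)]
  intro F
  rw [Finset.mem_erase, ← M.botFlat_val]
  simp [Subtype.ext_iff]

theorem zPoly_coeff (M : Matroid α) [M.Finite] (j : ℕ) : M.zPoly.coeff j =
    ∑ F : M.Flats, if M.natRk F.1 ≤ j then (M ／ F.1).klPoly.coeff (j - M.natRk F.1) else 0 := by
  rw [zPoly, finsetSum_coeff]
  simp only [coeff_X_pow_mul']

theorem zPoly_coeff_eq_zero (M : Matroid α) [M.Finite] {j : ℕ} (hj : M.natRank < j) :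
    M.zPoly.coeff j = 0 := by
  rw [zPoly_coeff]
  refine Finset.sum_eq_zero fun F _ => ?_
  have h1 := M.natRank_contract_add F.2.subset_ground
  rw [if_pos (by omega)]
  exact klPoly_coeff_eq_zero _ (by omega) (by omega)

theorem zPoly_coeff_natRank (M : Matroid α) [M.Finite] : M.zPoly.coeff M.natRank = 1 := by
  rw [zPoly_coeff, Fintype.sum_eq_single (⟨M.E, M.ground_isFlat⟩ : M.Flats)]
  · rw [if_pos (by exact le_rfl), klPoly_of_ground_eq_empty (by simp)]
    simp [natRank]
  · intro F hF
    have hlt := F.2.natRk_lt (F.2.subset_ground.ssubset_of_ne fun h => hF (Subtype.ext h))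
      subset_rfl
    rw [← natRank] at hlt
    have h1 := M.natRank_contract_add F.2.subset_ground
    rw [if_pos hlt.le]
    exact klPoly_coeff_eq_zero _ (by omega) (by omega)

theorem natDegree_zPoly (M : Matroid α) [M.Finite] : M.zPoly.natDegree = M.natRank := by
  refine le_antisymm (natDegree_le_iff_coeff_eq_zero.2 fun j hj => M.zPoly_coeff_eq_zero hj)
    (le_natDegree_of_ne_zero ?_)
  rw [zPoly_coeff_natRank]
  exact one_ne_zero

theorem zPoly_contract_botFlat (M : Matroid α) [M.Finite] :
    (M ／ M.botFlat.1).zPoly = M.zPoly := by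
  classical
  rw [zPoly_contract, Finset.filter_true_of_mem fun F _ => M.botFlat_le F, zPoly]
  simp [natRk_botFlat]

open Classical in
/-- The part of the `Z`-polynomial of `M` coming from the flats other than the least one. -/
noncomputable def properZ (M : Matroid α) [M.Finite] : ℤ[X] :=
  ∑ F ∈ Finset.univ.erase M.botFlat, X ^ M.natRk F.1 * (M ／ F.1).klPoly

theorem zPoly_eq (M : Matroid α) [M.Finite] [M.Loopless] : M.zPoly = M.klPoly + M.properZ := by
  classical
  rw [zPoly, ← Finset.add_sum_erase _ _ (Finset.mem_univ M.botFlat), natRk_botFlat, properZ,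
    pow_zero, one_mul]
  congr 1
  exact klPoly_congr (by rw [botFlat_val, contract_empty])

open Classical in
theorem sum_mu_le (M : Matroid α) [M.Finite] {F : M.Flats} (hF : F ≠ M.botFlat) :
    ∑ G ∈ Finset.univ.filter (· ≤ F), IncidenceAlgebra.mu ℤ M.botFlat G = 0 := by
  have h := IncidenceAlgebra.sum_Icc_mu_right (𝕜 := ℤ) M.botFlat F
  rw [if_neg hF.symm] at h
  rw [← h]
  refine Finset.sum_congr ?_ fun _ _ => by congr
  ext G
  simp [M.botFlat_le G]

-- Expand each Z_{M/G} over the flats F ≥ G and exchange the sums. For F ≠ ⊥ the values μ(⊥,G) over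
-- ⊥ ≠ G ≤ F add up to -1, and F = ⊥ lies above no G ≠ ⊥.
open Classical in
theorem sum_mu_mul_zPoly_contract (M : Matroid α) [M.Finite] :
    ∑ G ∈ Finset.univ.erase M.botFlat, C (IncidenceAlgebra.mu ℤ M.botFlat G) *
      (X ^ M.natRk G.1 * (M ／ G.1).zPoly) = -M.properZ := by
  have h1 : ∀ G : M.Flats, C (IncidenceAlgebra.mu ℤ M.botFlat G) *
      (X ^ M.natRk G.1 * (M ／ G.1).zPoly) = ∑ F ∈ Finset.univ.erase M.botFlat,
        (if G ≤ F then C (IncidenceAlgebra.mu ℤ M.botFlat G) else 0) *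
          (X ^ M.natRk F.1 * (M ／ F.1).klPoly) +
        (if G ≤ M.botFlat then C (IncidenceAlgebra.mu ℤ M.botFlat G) else 0) *
          (M ／ M.botFlat.1).klPoly := by
    intro G
    rw [zPoly_contract, Finset.mul_sum, Finset.mul_sum, Finset.sum_filter,
      ← Finset.sum_erase_add _ _ (Finset.mem_univ M.botFlat)]
    congr 1
    · refine Finset.sum_congr rfl fun F _ => ?_
      split_ifs with h
      · rw [← mul_assoc (X ^ _), ← pow_add, Nat.add_sub_cancel' (M.natRk_mono h)]
      · rw [zero_mul]
    · split_ifs with h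
      · have : G = M.botFlat := le_antisymm h (M.botFlat_le G)
        subst this
        simp [natRk_botFlat]
      · rw [zero_mul]
  rw [Finset.sum_congr rfl fun G _ => h1 G, Finset.sum_add_distrib, Finset.sum_comm, properZ]
  have h2 : ∑ G ∈ Finset.univ.erase M.botFlat,
      (if G ≤ M.botFlat then C (IncidenceAlgebra.mu ℤ M.botFlat G) else 0) *
        (M ／ M.botFlat.1).klPoly = 0 := by
    refine Finset.sum_eq_zero fun G hG => ?_
    rw [if_neg, zero_mul]
    exact fun h => (Finset.mem_erase.1 hG).1 (le_antisymm h (M.botFlat_le G))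
  rw [h2, add_zero, ← Finset.sum_neg_distrib]
  refine Finset.sum_congr rfl fun F hF => ?_
  rw [← Finset.sum_mul, ← Finset.sum_filter, neg_eq_neg_one_mul]
  congr 1
  have h3 := M.sum_mu_le (Finset.mem_erase.1 hF).1
  rw [← Finset.add_sum_erase _ _
    (show M.botFlat ∈ Finset.univ.filter (fun G => G ≤ F) from
      Finset.mem_filter.2 ⟨Finset.mem_univ _, M.botFlat_le F⟩),
    IncidenceAlgebra.mu_self] at h3
  have h4 : (Finset.univ.erase M.botFlat).filter (fun G => G ≤ F) =
      (Finset.univ.filter (fun G => G ≤ F)).erase M.botFlat := by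
    ext; simp [and_comm]
  rw [h4, ← map_sum, eq_neg_of_add_eq_zero_right h3]
  simp

-- Expand the characteristic polynomials. The term G = ⊥ contributes t^(rk F), which gives
-- `properZ`; for G ≠ ⊥, summing over F ≥ G first yields the Z-polynomial of M/G.
open Classical in
theorem sum_charPoly_mul_klPoly (M : Matroid α) [M.Finite] :
    ∑ F ∈ Finset.univ.erase M.botFlat, (M.localization F).charPoly * (M ／ F.1).klPoly =
      ∑ G ∈ Finset.univ.erase M.botFlat,
        C (IncidenceAlgebra.mu ℤ M.botFlat G) * (M ／ G.1).zPoly + M.properZ := by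
  have h1 : ∀ F : M.Flats, (M.localization F).charPoly * (M ／ F.1).klPoly =
      ∑ G ∈ Finset.univ.erase M.botFlat, C (IncidenceAlgebra.mu ℤ M.botFlat G) *
        (if G ≤ F then X ^ (M.natRk F.1 - M.natRk G.1) * (M ／ F.1).klPoly else 0) +
      X ^ M.natRk F.1 * (M ／ F.1).klPoly := by
    intro F
    rw [charPoly_localization, Finset.sum_filter, Finset.sum_mul,
      ← Finset.sum_erase_add _ _ (Finset.mem_univ M.botFlat)]
    congr 1
    · refine Finset.sum_congr rfl fun G _ => ?_
      split_ifs
      · ring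
      · ring
    · rw [if_pos (M.botFlat_le F), IncidenceAlgebra.mu_self, natRk_botFlat]
      simp
  rw [Finset.sum_congr rfl fun F _ => h1 F, Finset.sum_add_distrib, properZ, Finset.sum_comm]
  congr 1
  refine Finset.sum_congr rfl fun G hG => ?_
  rw [← Finset.mul_sum, zPoly_contract, ← Finset.sum_filter]
  congr 1
  refine Finset.sum_congr ?_ fun _ _ => rfl
  ext F
  simp only [Finset.mem_filter, Finset.mem_erase, Finset.mem_univ, and_true, true_and,
    and_iff_right_iff_imp]
  rintro h rfl
  exact (Finset.mem_erase.1 hG).1 (le_antisymm h (M.botFlat_le G))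

/-- The `Z`-polynomial is palindromic. -/
theorem zPoly_reflect (M : Matroid α) [hM : M.Finite] : M.zPoly.reflect M.natRank = M.zPoly := by
  classical
  induction hn : M.E.ncard using Nat.strong_induction_on generalizing M with
  | _ n ih =>
  subst hn
  by_cases hE : M.E = ∅
  · have h0 : M.natRank = 0 := by rw [natRank, hE, natRk, eRk_empty]; rfl
    have hd := M.natDegree_zPoly
    rw [h0] at hd ⊢
    rw [eq_C_of_natDegree_eq_zero hd, reflect_C, pow_zero, mul_one]
  by_cases hl : M.Loopless
  · set k := M.natRank with hk
    set A := ∑ G ∈ Finset.univ.erase M.botFlat,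
        C (IncidenceAlgebra.mu ℤ M.botFlat G) * (M ／ G.1).zPoly with hA
    -- Each M/G with G ≠ ⊥ has a smaller ground set, so its Z is palindromic of degree k - rk G, and
    -- reflecting in degree k only adds the factor t^(rk G).
    have hArefl : A.reflect k = -M.properZ := by
      rw [← sum_mu_mul_zPoly_contract, hA, reflect_sum]
      refine Finset.sum_congr rfl fun G hG => ?_
      have hne : G.1 ≠ ∅ := fun h => (Finset.mem_erase.1 hG).1
        (Subtype.ext (h.trans M.botFlat_val.symm))
      have hr := M.natRank_contract_add G.2.subset_ground
      rw [reflect_C_mul, hk, ← hr, add_comm, reflect_add_eq_X_pow_mul _ (natDegree_zPoly _).le,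
        ih _ (M.ncard_contract_lt G hne) _ rfl]
    have hTrefl : M.properZ.reflect k = -A := by
      ext i
      have h := congrArg (fun p => p.coeff (revAt k i)) hArefl
      simp only [coeff_reflect, revAt_invol, coeff_neg] at h
      rw [coeff_reflect, coeff_neg, h, neg_neg]
    have hR := M.sum_charPoly_mul_klPoly
    rw [← hA] at hR
    have hcA : ∀ i ≤ k, A.coeff (k - i) = -M.properZ.coeff i := fun i hi => by
      rw [← coeff_neg, ← hArefl, coeff_reflect, revAt_le hi]
    have hcT : ∀ i ≤ k, M.properZ.coeff (k - i) = -A.coeff i := fun i hi => by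
      rw [← coeff_neg, ← hTrefl, coeff_reflect, revAt_le hi]
    have hP : ∀ i, 2 * i < k → M.klPoly.coeff i = -(A.coeff i + M.properZ.coeff i) :=
      fun i hi => by rw [klPoly_coeff M hE hi, hR, coeff_add]
    have hP0 : ∀ i, k ≤ 2 * i → i ≠ 0 → M.klPoly.coeff i = 0 :=
      fun i hi hi0 => M.klPoly_coeff_eq_zero hi0 hi
    have hkpos : k ≠ 0 := by
      intro h0
      have h1 := M.cast_natRk M.E
      rw [← natRank, ← hk, h0] at h1
      have h2 := (M.eRk_eq_zero_iff subset_rfl).1 h1.symm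
      rw [M.loops_eq_empty] at h2
      exact hE (Set.subset_empty_iff.1 h2)
    ext i
    rw [coeff_reflect]
    rcases le_or_gt i k with hi | hi
    · rw [revAt_le hi, zPoly_eq, coeff_add, coeff_add, hcT i hi]
      have h1 := hcT i hi
      have h2 := hcA i hi
      -- Below the middle the coefficient of Z is -A_i = T_{k-i}, and P contributes nothing at k-i.
      -- The middle coefficient is its own mirror image.
      rcases lt_trichotomy (2 * i) k with h | h | h
      · rw [hP i h, hP0 (k - i) (by omega) (by omega)]
        ring
      · have e : k - i = i := by omega
        rw [e] at h1 h2 ⊢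
        rw [h1]
      · rw [hP0 i h.le (by omega), hP (k - i) (by omega), h1, h2]
        ring
    · rw [revAt_eq_self_of_lt hi]
  -- If there are loops, contracting them does not change Z and shrinks the ground set.
  · have hne : M.botFlat.1 ≠ ∅ := by
      intro h
      exact hl ((loopless_iff_forall_not_isLoop).2 fun e _ he =>
        Set.notMem_empty e (h ▸ (he : e ∈ M.closure ∅)))
    have h := ih _ (M.ncard_contract_lt _ hne) (M ／ M.botFlat.1) rfl
    have hr := M.natRank_contract_add M.botFlat.2.subset_ground
    rw [natRk_botFlat, add_zero] at hr
    rwa [zPoly_contract_botFlat, hr] at h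

/-! ### Flats and hyperplanes of paving matroids. -/

theorem cast_natRank (M : Matroid α) [M.RankFinite] : (M.natRank : ℕ∞) = M.eRank := by
  rw [natRank, cast_natRk, eRk_ground]

theorem Indep.natRk_eq {M : Matroid α} [M.Finite] {X : Set α} (h : M.Indep X) :
    M.natRk X = X.ncard := by
  rw [natRk, h.eRk_eq_encard, Set.ncard]

theorem natRk_le_ncard (M : Matroid α) [M.Finite] {X : Set α} (hX : X ⊆ M.E) :
    M.natRk X ≤ X.ncard := by
  have h := M.eRk_le_encard X
  rw [← cast_natRk, ← (M.ground_finite.subset hX).cast_ncard_eq] at h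
  exact_mod_cast h

theorem IsPaving.indep {M : Matroid α} [M.Finite] (hM : M.IsPaving) {X : Set α} (hX : X ⊆ M.E)
    (h : X.ncard < M.natRank) : M.Indep X := by
  rw [indep_iff_forall_subset_not_isCircuit hX]
  intro C hC hcirc
  have h1 := (hM C hcirc).trans (Set.encard_le_encard hC)
  rw [← cast_natRank, ← (M.ground_finite.subset hX).cast_ncard_eq] at h1
  have : M.natRank ≤ X.ncard := by exact_mod_cast h1
  omega

/-- Adding any element leaves fewer than k elements, hence an independent set, so no new element
lies in the closure. -/
theorem IsPaving.isFlat {M : Matroid α} [M.Finite] (hM : M.IsPaving) {X : Set α} (hX : X ⊆ M.E)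
    (h : X.ncard + 2 ≤ M.natRank) : M.IsFlat X := by
  rw [isFlat_iff_closure_eq]
  refine subset_antisymm (fun e he => ?_) (M.subset_closure X)
  by_contra heX
  have heE : e ∈ M.E := M.closure_subset_ground X he
  have hI := hM.indep (X := insert e X) (Set.insert_subset heE hX)
    ((Nat.lt_of_le_of_lt (Set.ncard_insert_le e X)) (by omega))
  have := (hI.notMem_closure_sdiff_of_mem (Set.mem_insert e X))
  rw [Set.insert_sdiff_self_of_notMem heX] at this
  exact this he

theorem IsPaving.indep_of_isFlat {M : Matroid α} [M.Finite] (hM : M.IsPaving) {F : Set α}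
    (hF : M.IsFlat F) (h : M.natRk F + 2 ≤ M.natRank) : M.Indep F := by
  obtain ⟨I, hI⟩ := M.exists_isBasis F hF.subset_ground
  have h1 : M.natRk F = I.ncard := by rw [natRk, ← hI.encard_eq_eRk, Set.ncard]
  have h2 := hM.isFlat hI.indep.subset_ground (by omega)
  have h3 : F = I := by rw [← hF.closure, ← hI.closure_eq_closure, h2.closure]
  rw [h3]
  exact hI.indep

theorem loopless_contract {M : Matroid α} {F : Set α} (hF : M.IsFlat F) : (M ／ F).Loopless := by
  rw [loopless_iff_forall_not_isLoop]
  intro e _ he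
  have : e ∈ (M ／ F).loops := he
  rw [contract_loops_eq, hF.closure] at this
  exact this.2 this.1

/-- A circuit of M/F lies, together with F, over a circuit of M, so it has at least k - |F|
elements; this is the rank of M/F because F is independent. -/
theorem IsPaving.contract {M : Matroid α} [M.Finite] (hM : M.IsPaving) {F : Set α}
    (hF : M.Indep F) : (M ／ F).IsPaving := by
  intro K hK
  obtain ⟨C', hC', -, hC'K⟩ := hK.exists_subset_isCircuit_of_contract
  have h1 := (hM C' hC').trans ((Set.encard_le_encard hC'K).trans (Set.encard_union_le K F))
  have hKE : K ⊆ M.E := hK.subset_ground.trans Set.sdiff_subset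
  rw [← cast_natRank, ← (M.ground_finite.subset hKE).cast_ncard_eq,
    ← (M.ground_finite.subset hF.subset_ground).cast_ncard_eq] at h1
  rw [← cast_natRank, ← (M.ground_finite.subset hKE).cast_ncard_eq]
  have h2 : M.natRank ≤ K.ncard + F.ncard := by exact_mod_cast h1
  have h3 := M.natRank_contract_add hF.subset_ground
  rw [hF.natRk_eq] at h3
  have h4 : (M ／ F).natRank ≤ K.ncard := by omega
  exact_mod_cast h4

/-- The constant term of P is that of Z, and by palindromicity this is the leading coefficient of Z.
-/
theorem klPoly_coeff_zero (M : Matroid α) [M.Finite] [M.Loopless] : M.klPoly.coeff 0 = 1 := by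
  have h1 : M.zPoly.coeff 0 = M.klPoly.coeff 0 := by
    rw [zPoly_eq, coeff_add, add_eq_left, properZ, finsetSum_coeff]
    refine Finset.sum_eq_zero fun F hF => ?_
    have hlt := M.botFlat.2.natRk_lt (X := F.1)
      (Set.ssubset_iff_subset_ne.2 ⟨M.botFlat_le F, fun h => (Finset.mem_erase.1 hF).1
        (Subtype.ext h.symm)⟩) F.2.subset_ground
    rw [coeff_X_pow_mul', if_neg (by omega)]
  rw [← h1, ← M.zPoly_reflect, coeff_reflect, revAt_le (Nat.zero_le _), Nat.sub_zero,
    zPoly_coeff_natRank]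

theorem klPoly_eq_one (M : Matroid α) [M.Finite] [M.Loopless] (h : M.natRank ≤ 2) :
    M.klPoly = 1 := by
  ext i
  rcases eq_or_ne i 0 with rfl | hi
  · simp [klPoly_coeff_zero]
  · rw [klPoly_coeff_eq_zero M hi (by omega), coeff_one, if_neg hi]

open Classical in
/-- The hyperplanes of a matroid. -/
noncomputable def hyperplanes (M : Matroid α) [M.Finite] : Finset M.Flats :=
  Finset.univ.filter fun H => M.natRk H.1 + 1 = M.natRank

theorem mem_hyperplanes {M : Matroid α} [M.Finite] {H : M.Flats} :
    H ∈ M.hyperplanes ↔ M.natRk H.1 + 1 = M.natRank := by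
  simp [hyperplanes]

open Classical in
theorem IsPaving.card_flats {M : Matroid α} [M.Finite] (hM : M.IsPaving) {S : Set α} (hS : S ⊆ M.E)
    {i : ℕ} (hi : i + 2 ≤ M.natRank) :
    (Finset.univ.filter fun F : M.Flats => F.1 ⊆ S ∧ M.natRk F.1 = i).card =
      S.ncard.choose i := by
  have hSf := M.ground_finite.subset hS
  rw [Set.ncard_eq_toFinset_card S hSf, ← Finset.card_powersetCard]
  symm
  have hsub : ∀ t ∈ hSf.toFinset.powersetCard i, (t : Set α) ⊆ S ∧ (t : Set α).ncard = i := by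
    intro t ht
    rw [Finset.mem_powersetCard] at ht
    exact ⟨fun x hx => hSf.mem_toFinset.1 (ht.1 hx), by rw [Set.ncard_coe_finset, ht.2]⟩
  refine Finset.card_bij (fun t ht => ⟨t, hM.isFlat ((hsub t ht).1.trans hS)
    (by rw [(hsub t ht).2]; exact hi)⟩) ?_ ?_ ?_
  · intro t ht
    refine Finset.mem_filter.2 ⟨Finset.mem_univ _, (hsub t ht).1, ?_⟩
    have := hM.indep ((hsub t ht).1.trans hS) (by rw [(hsub t ht).2]; omega)
    exact this.natRk_eq.trans (hsub t ht).2
  · intro t _ t' _ h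
    exact Finset.coe_injective (congrArg (fun K => K.1) h)
  · intro F hF
    obtain ⟨-, h1, h2⟩ := Finset.mem_filter.1 hF
    have hFf := M.ground_finite.subset F.2.subset_ground
    refine ⟨hFf.toFinset, ?_, Subtype.ext (by simp)⟩
    rw [Finset.mem_powersetCard]
    refine ⟨fun x hx => hSf.mem_toFinset.2 (h1 (hFf.mem_toFinset.1 hx)), ?_⟩
    rw [← Set.ncard_eq_toFinset_card _ hFf, ← h2, (hM.indep_of_isFlat F.2 (by omega)).natRk_eq]

open Classical in
theorem IsPaving.sum_flats {M : Matroid α} [M.Finite] (hM : M.IsPaving) {S : Set α} (hS : S ⊆ M.E)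
    (φ : ℕ → ℤ[X]) :
    ∑ F ∈ Finset.univ.filter (fun F : M.Flats => F.1 ⊆ S ∧ M.natRk F.1 + 2 ≤ M.natRank),
      φ (M.natRk F.1) = ∑ i ∈ Finset.range (M.natRank - 1), (S.ncard.choose i : ℤ[X]) * φ i := by
  rw [← Finset.sum_fiberwise_of_maps_to (t := Finset.range (M.natRank - 1))
    (g := fun F : M.Flats => M.natRk F.1)]
  · refine Finset.sum_congr rfl fun i hi => ?_
    have hi := Finset.mem_range.1 hi
    rw [← hM.card_flats hS (i := i) (by omega), ← nsmul_eq_mul, ← Finset.sum_const]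
    refine Finset.sum_congr ?_ ?_
    · ext F
      simp only [Finset.mem_filter, Finset.mem_univ, true_and]
      constructor
      · rintro ⟨⟨h1, _⟩, h2⟩
        exact ⟨h1, h2⟩
      · rintro ⟨h1, h2⟩
        exact ⟨⟨h1, by omega⟩, h2⟩
    · intro F hF
      rw [(Finset.mem_filter.1 hF).2.2]
  · intro F hF
    have := (Finset.mem_filter.1 hF).2.2
    exact Finset.mem_range.2 (by omega)

/-- Every (k-1)-set is independent, and its closure is the one hyperplane that contains it. -/
theorem IsPaving.sum_choose_hyperplanes {M : Matroid α} [M.Finite] (hM : M.IsPaving)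
    (hk : 1 ≤ M.natRank) :
    ∑ H ∈ M.hyperplanes, H.1.ncard.choose (M.natRank - 1) =
      M.E.ncard.choose (M.natRank - 1) := by
  classical
  set k := M.natRank with hkdef
  have hEf := M.ground_finite
  rw [Set.ncard_eq_toFinset_card M.E hEf, ← Finset.card_powersetCard]
  have hsub : ∀ t ∈ hEf.toFinset.powersetCard (k - 1),
      (t : Set α) ⊆ M.E ∧ (t : Set α).ncard = k - 1 := by
    intro t ht
    rw [Finset.mem_powersetCard] at ht
    exact ⟨fun x hx => hEf.mem_toFinset.1 (ht.1 hx), by rw [Set.ncard_coe_finset, ht.2]⟩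
  have hrk : ∀ t ∈ hEf.toFinset.powersetCard (k - 1), M.natRk (t : Set α) = k - 1 := by
    intro t ht
    obtain ⟨h1, h2⟩ := hsub t ht
    rw [← h2]
    exact (hM.indep h1 (by omega)).natRk_eq
  rw [Finset.card_eq_sum_card_fiberwise (t := M.hyperplanes)
    (f := fun t : Finset α => (⟨M.closure t, M.isFlat_closure _⟩ : M.Flats))]
  · refine Finset.sum_congr rfl fun H hH => ?_
    have hH := mem_hyperplanes.1 hH
    have hHf := hEf.subset H.2.subset_ground
    rw [Set.ncard_eq_toFinset_card H.1 hHf, ← Finset.card_powersetCard]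
    congr 1
    ext t
    simp only [Finset.mem_filter]
    constructor
    · intro ht
      rw [Finset.mem_powersetCard] at ht
      have htH : (t : Set α) ⊆ H.1 := fun x hx => hHf.mem_toFinset.1 (ht.1 hx)
      have htp : t ∈ hEf.toFinset.powersetCard (k - 1) := Finset.mem_powersetCard.2
        ⟨fun x hx => hEf.mem_toFinset.2 (H.2.subset_ground (htH hx)), ht.2⟩
      refine ⟨htp, Subtype.ext ?_⟩
      have hcl : M.closure t ⊆ H.1 := by
        rw [← H.2.closure]
        exact M.closure_subset_closure htH
      by_contra hne
      have hlt := (M.isFlat_closure (t : Set α)).natRk_lt (hcl.ssubset_of_ne hne)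
        H.2.subset_ground
      have : M.natRk (M.closure t) = M.natRk t := by rw [natRk, eRk_closure_eq, natRk]
      rw [this, hrk t htp] at hlt
      omega
    · rintro ⟨ht, h⟩
      have h := congrArg (fun K => K.1) h
      simp only at h
      rw [Finset.mem_powersetCard]
      refine ⟨fun x hx => hHf.mem_toFinset.2 ?_, (Finset.mem_powersetCard.1 ht).2⟩
      rw [← h]
      exact M.subset_closure (t : Set α) (hsub t ht).1 hx
  · intro t ht
    rw [Finset.mem_coe, mem_hyperplanes]
    have : M.natRk (M.closure t) = M.natRk t := by rw [natRk, eRk_closure_eq, natRk]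
    rw [this, hrk t ht]
    omega

end Matroid

/-! ### Uniform matroids and the corrections attached to hyperplanes. -/

theorem uniformMatroid_indep_iff {k n : ℕ} (I : Set (Fin n)) :
    (uniformMatroid k n).Indep I ↔ I.ncard ≤ k := Iff.rfl

theorem uniformMatroid_ground (k n : ℕ) : (uniformMatroid k n).E = Set.univ := rfl

theorem ncard_uniformMatroid_ground (k n : ℕ) : (uniformMatroid k n).E.ncard = n := by
  rw [uniformMatroid_ground, Set.ncard_univ, Nat.card_fin]

theorem uniformMatroid_eRank {k n : ℕ} (h : k ≤ n) : (uniformMatroid k n).eRank = k := by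
  obtain ⟨B, hB⟩ := (uniformMatroid k n).exists_isBase
  rw [← hB.encard_eq_eRank, ← B.toFinite.cast_ncard_eq, (uniformMatroid_isBase_iff h B).1 hB]

theorem natRank_uniformMatroid {k n : ℕ} (h : k ≤ n) : (uniformMatroid k n).natRank = k := by
  rw [Matroid.natRank_eq, uniformMatroid_eRank h, ENat.toNat_natCast]

theorem uniformMatroid_isPaving {k n : ℕ} (h : k ≤ n) : (uniformMatroid k n).IsPaving := by
  intro K hK
  rw [uniformMatroid_eRank h, ← K.toFinite.cast_ncard_eq]
  have := hK.not_indep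
  rw [uniformMatroid_indep_iff] at this
  exact_mod_cast (by omega : k ≤ K.ncard)

theorem uniformMatroid_loopless {k n : ℕ} (h : 1 ≤ k) : (uniformMatroid k n).Loopless := by
  rw [Matroid.loopless_iff_forall_isNonloop]
  intro e _
  rw [← Matroid.indep_singleton, uniformMatroid_indep_iff, Set.ncard_singleton]
  exact h

theorem ncard_eq_of_mem_hyperplanes_uniformMatroid {k n : ℕ} (h : k ≤ n)
    {H : (uniformMatroid k n).Flats} (hH : H ∈ (uniformMatroid k n).hyperplanes) :
    H.1.ncard + 1 = k := by
  have h1 := Matroid.mem_hyperplanes.1 hH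
  rw [natRank_uniformMatroid h] at h1
  by_contra hne
  by_cases hlt : H.1.ncard ≤ k
  · have := Matroid.Indep.natRk_eq ((uniformMatroid_indep_iff H.1).2 hlt)
    omega
  · obtain ⟨I, hIH, hI⟩ := Set.exists_subset_card_eq (s := H.1) (n := k) (by omega)
    have h2 := Matroid.Indep.natRk_eq ((uniformMatroid_indep_iff I).2 hI.le)
    have h3 := (uniformMatroid k n).natRk_mono hIH
    omega

/-- The Kazhdan--Lusztig polynomial of `U_{k,n}`. -/
noncomputable def uniformKL (k n : ℕ) : ℤ[X] := (uniformMatroid k n).klPoly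

/-- The change of the Kazhdan--Lusztig polynomial on relaxing a hyperplane with `h` elements. -/
noncomputable def relaxKL (k h : ℕ) : ℤ[X] :=
  if k ≤ h then uniformKL k (h + 1) - uniformKL (k - 1) h else 0

/-- The `Z`-polynomial of `U_{k,n}`, expanded. -/
noncomputable def uniformZ (k n : ℕ) : ℤ[X] :=
  ∑ i ∈ Finset.range k, (n.choose i : ℤ[X]) * (X ^ i * uniformKL (k - i) (n - i)) + X ^ k

/-- The change of the `Z`-polynomial on relaxing a hyperplane with `h` elements. -/
noncomputable def relaxZ (k h : ℕ) : ℤ[X] :=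
  ∑ i ∈ Finset.range (k - 1), (h.choose i : ℤ[X]) * (X ^ i * relaxKL (k - i) (h - i)) +
    ((h.choose (k - 1) : ℤ[X]) - 1) * X ^ (k - 1)

theorem uniformKL_one {n : ℕ} (hn : 1 ≤ n) : uniformKL 1 n = 1 := by
  have := uniformMatroid_loopless (k := 1) (n := n) le_rfl
  exact Matroid.klPoly_eq_one _ (by rw [natRank_uniformMatroid hn]; omega)

/-- Hyperplanes with k-1 elements need no correction; this is why `relaxKL k h` is set to zero for h
< k. -/
theorem relaxZ_pred {k : ℕ} (hk : 1 ≤ k) : relaxZ k (k - 1) = 0 := by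
  rw [relaxZ, Finset.sum_eq_zero, Nat.choose_self]
  · simp
  · intro i hi
    have := Finset.mem_range.1 hi
    rw [relaxKL, if_neg (by omega)]
    simp

/-- Split binom(h+1, i) by Pascal's rule. One half is t times the Z-sum of U_{k-1,h}; subtracting
that Z-sum from the other half turns each P_{U_{k-i,h-i+1}} into `relaxKL (k-i) (h-i)`. -/
theorem uniformZ_sub_uniformZ {k h : ℕ} (hk : 2 ≤ k) (hkh : k ≤ h) :
    uniformZ k (h + 1) - (1 + X) * uniformZ (k - 1) h = relaxZ k h := by
  obtain ⟨k, rfl⟩ : ∃ k', k = k' + 1 := ⟨k - 1, by omega⟩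
  have h1 : uniformZ (k + 1) (h + 1) = X * (∑ i ∈ Finset.range k,
      (h.choose i : ℤ[X]) * (X ^ i * uniformKL (k - i) (h - i))) +
      (∑ i ∈ Finset.range k, (h.choose i : ℤ[X]) *
        (X ^ i * uniformKL (k + 1 - i) (h - i + 1)) + (h.choose k : ℤ[X]) * X ^ k) + X ^ (k + 1) := by
    have h2 : ∑ i ∈ Finset.range k, (h.choose i : ℤ[X]) *
        (X ^ i * uniformKL (k + 1 - i) (h - i + 1)) + (h.choose k : ℤ[X]) * X ^ k =
        ∑ i ∈ Finset.range (k + 1), (h.choose i : ℤ[X]) *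
          (X ^ i * uniformKL (k + 1 - i) (h + 1 - i)) := by
      rw [Finset.sum_range_succ, Nat.add_sub_cancel_left, uniformKL_one (by omega), mul_one]
      congr 1
      refine Finset.sum_congr rfl fun i hi => ?_
      have := Finset.mem_range.1 hi
      rw [show h + 1 - i = h - i + 1 by omega]
    rw [h2, uniformZ, Finset.sum_range_succ', Finset.sum_range_succ', Finset.mul_sum, ← add_assoc,
      ← Finset.sum_add_distrib]
    congr 2
    · refine Finset.sum_congr rfl fun i _ => ?_
      rw [Nat.choose_succ_succ, Nat.add_sub_add_right, Nat.add_sub_add_right]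
      push_cast
      ring
    · simp
  have h3 : ∑ i ∈ Finset.range k, (h.choose i : ℤ[X]) *
        (X ^ i * relaxKL (k + 1 - i) (h - i)) =
      ∑ i ∈ Finset.range k, (h.choose i : ℤ[X]) *
        (X ^ i * uniformKL (k + 1 - i) (h - i + 1)) -
      ∑ i ∈ Finset.range k, (h.choose i : ℤ[X]) * (X ^ i * uniformKL (k - i) (h - i)) := by
    rw [← Finset.sum_sub_distrib]
    refine Finset.sum_congr rfl fun i hi => ?_
    have := Finset.mem_range.1 hi
    rw [relaxKL, if_pos (by omega), show k + 1 - i - 1 = k - i by omega]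
    ring
  rw [h1, relaxZ, Nat.add_sub_cancel, h3, uniformZ]
  ring

theorem uniformKL_coeff_eq_zero {k n i : ℕ} (h : k ≤ n) (hi : i ≠ 0) (hki : k ≤ 2 * i) :
    (uniformKL k n).coeff i = 0 :=
  Matroid.klPoly_coeff_eq_zero _ hi (by rwa [natRank_uniformMatroid h])

theorem relaxKL_coeff_eq_zero {k h i : ℕ} (hi : i ≠ 0) (hki : k ≤ 2 * i) :
    (relaxKL k h).coeff i = 0 := by
  rw [relaxKL]
  split_ifs with hkh
  · rw [coeff_sub, uniformKL_coeff_eq_zero (by omega) hi hki,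
      uniformKL_coeff_eq_zero (by omega) hi (by omega), sub_zero]
  · simp

/-! ### Kazhdan–Lusztig and Z-polynomials of paving matroids. -/

namespace Matroid

universe u

/-- The Kazhdan--Lusztig polynomials of loopless paving matroids of rank `k` are obtained from that
of the uniform matroid by a correction for each hyperplane. -/
def PavingKLFormula (k : ℕ) : Prop :=
  ∀ (α : Type u) (M : Matroid α) [M.Finite] [M.Loopless], M.IsPaving → M.natRank = k →
    M.klPoly = uniformKL k M.E.ncard - ∑ H ∈ M.hyperplanes, relaxKL k H.1.ncard

theorem pavingKLFormula_one : PavingKLFormula.{u} 1 := by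
  intro α M _ _ _ hk
  have hE : 1 ≤ M.E.ncard := hk ▸ M.natRk_le_ncard subset_rfl
  rw [klPoly_eq_one _ (by omega), uniformKL_one hE, Finset.sum_eq_zero, sub_zero]
  intro H hH
  have h1 := mem_hyperplanes.1 hH
  have h3 : M.eRk H.1 = 0 := by rw [← cast_natRk]; exact_mod_cast (by omega : M.natRk H.1 = 0)
  rw [M.eRk_eq_zero_iff H.2.subset_ground, M.loops_eq_empty, Set.subset_empty_iff] at h3
  rw [h3, Set.ncard_empty, relaxKL, if_neg (by omega)]

open Classical in
/-- The sum of a function of the cardinality over the hyperplanes of a contraction. -/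
theorem sum_hyperplanes_contract {α : Type*} (M : Matroid α) [M.Finite] (F : M.Flats)
    (f : ℕ → ℤ[X]) : ∑ G ∈ (M ／ F.1).hyperplanes, f G.1.ncard =
      ∑ H ∈ M.hyperplanes, if F.1 ⊆ H.1 then f (H.1.ncard - F.1.ncard) else 0 := by
  have h := M.sum_flats_contract F
    (fun H => if M.natRk H + 1 = M.natRank then f (H.ncard - F.1.ncard) else 0)
  rw [hyperplanes, hyperplanes, Finset.sum_filter, ← Finset.sum_filter _ (f := fun H : M.Flats =>
    f (H.1.ncard - F.1.ncard)), Finset.filter_filter, Finset.sum_filter]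
  rw [Finset.sum_filter] at h
  refine Eq.trans (Eq.trans ?_ h) ?_
  · refine Finset.sum_congr rfl fun G _ => ?_
    have h1 := ((isFlat_contract_iff F.2.subset_ground).1 G.2).2
    have h2 := M.natRank_contract_add F.2.subset_ground
    have h3 := M.natRk_contract_add F.1 G.1
    have h4 : (G.1 ∪ F.1).ncard = G.1.ncard + F.1.ncard :=
      Set.ncard_union_eq h1 ((M ／ F.1).ground_finite.subset G.2.subset_ground)
        (M.ground_finite.subset F.2.subset_ground)
    rw [h4, Nat.add_sub_cancel]
    refine if_congr ?_ rfl rfl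
    omega
  · refine Finset.sum_congr rfl fun H _ => ?_
    by_cases h1 : F ≤ H
    · have h1' : F.1 ⊆ H.1 := h1
      simp [h1, h1']
    · have h1' : ¬ F.1 ⊆ H.1 := h1
      simp [h1, h1']

/-- The `Z`-polynomial of a loopless paving matroid in terms of those of smaller rank. -/
theorem IsPaving.zPoly_eq_aux {α : Type u} {M : Matroid α} [M.Finite] [M.Loopless]
    (hM : M.IsPaving) (hk : 2 ≤ M.natRank)
    (ih : ∀ k' < M.natRank, 1 ≤ k' → PavingKLFormula.{u} k') :
    M.zPoly = (M.klPoly - (uniformKL M.natRank M.E.ncard -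
        ∑ H ∈ M.hyperplanes, relaxKL M.natRank H.1.ncard)) +
      (uniformZ M.natRank M.E.ncard - ∑ H ∈ M.hyperplanes, relaxZ M.natRank H.1.ncard) := by
  classical
  set k := M.natRank with hkdef
  set n := M.E.ncard with hndef
  -- The induction hypothesis covers M/F only for F ≠ ⊥. The term F = ⊥ is P_M itself, and D records
  -- its deviation from the expected value.
  set D := M.klPoly - (uniformKL k n - ∑ H ∈ M.hyperplanes, relaxKL k H.1.ncard) with hD
  have hkn : k ≤ n := M.natRk_le_ncard subset_rfl
  have hlow : ∀ F : M.Flats, M.natRk F.1 + 2 ≤ k → X ^ M.natRk F.1 * (M ／ F.1).klPoly =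
      (if F = M.botFlat then D else 0) + X ^ M.natRk F.1 * uniformKL (k - M.natRk F.1)
        (n - M.natRk F.1) - ∑ H ∈ M.hyperplanes,
          if F.1 ⊆ H.1 then X ^ M.natRk F.1 *
            relaxKL (k - M.natRk F.1) (H.1.ncard - M.natRk F.1) else 0 := by
    intro F hF
    have hI := hM.indep_of_isFlat F.2 hF
    split_ifs with hb
    · subst hb
      have e : (M ／ M.botFlat.1).klPoly = M.klPoly :=
        klPoly_congr (by rw [botFlat_val, contract_empty])
      rw [e, natRk_botFlat, hD]
      simp [botFlat_val]
      ring
    · have hlt := M.botFlat.2.natRk_lt (X := F.1)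
        (Set.ssubset_iff_subset_ne.2 ⟨M.botFlat_le F, fun h => hb (Subtype.ext h.symm)⟩)
        F.2.subset_ground
      have hr := M.natRank_contract_add F.2.subset_ground
      have := loopless_contract F.2
      rw [ih (k - M.natRk F.1) (by omega) (by omega) α (M ／ F.1) (hM.contract hI) (by omega),
        sum_hyperplanes_contract M F (fun c => relaxKL (k - M.natRk F.1) c), contract_ground,
        Set.ncard_sdiff F.2.subset_ground (M.ground_finite.subset F.2.subset_ground),
        ← hI.natRk_eq, mul_sub, zero_add, Finset.mul_sum]
      congr 1
      refine Finset.sum_congr rfl fun H _ => ?_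
      split_ifs
      · rfl
      · rw [mul_zero]
  have htop : ∀ F : M.Flats, F ∈ M.hyperplanes → X ^ M.natRk F.1 * (M ／ F.1).klPoly =
      X ^ (k - 1) := by
    intro F hF
    have h1 := mem_hyperplanes.1 hF
    have hr := M.natRank_contract_add F.2.subset_ground
    have := loopless_contract F.2
    rw [klPoly_eq_one _ (by omega), mul_one]
    congr 1
    omega
  have hsplit : M.zPoly =
      ∑ F ∈ Finset.univ.filter (fun F : M.Flats => F.1 ⊆ M.E ∧ M.natRk F.1 + 2 ≤ k),
        X ^ M.natRk F.1 * (M ／ F.1).klPoly +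
      (∑ F ∈ M.hyperplanes, X ^ M.natRk F.1 * (M ／ F.1).klPoly + X ^ k) := by
    set Ef : M.Flats := ⟨M.E, M.ground_isFlat⟩ with hEf
    have hE : X ^ M.natRk Ef.1 * (M ／ Ef.1).klPoly = X ^ k := by
      rw [klPoly_of_ground_eq_empty (by simp [hEf]), mul_one, hkdef, natRank]
    rw [zPoly, ← Finset.sum_filter_add_sum_filter_not _
      (fun F : M.Flats => F.1 ⊆ M.E ∧ M.natRk F.1 + 2 ≤ k)]
    congr 1
    rw [← hE, ← Finset.sum_erase_add (a := Ef)]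
    · congr 1
      refine Finset.sum_congr ?_ fun _ _ => rfl
      ext F
      simp only [Finset.mem_erase, Finset.mem_filter, Finset.mem_univ, true_and, mem_hyperplanes]
      constructor
      · rintro ⟨h1, h2⟩
        have h3 := F.2.natRk_lt (F.2.subset_ground.ssubset_of_ne fun h => h1 (Subtype.ext h))
          subset_rfl
        have h4 : ¬ (M.natRk F.1 + 2 ≤ k) := fun h => h2 ⟨F.2.subset_ground, h⟩
        rw [← natRank] at h3
        omega
      · intro h1
        refine ⟨?_, by omega⟩
        rintro rfl
        rw [hEf, ← natRank] at h1
        omega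
    · have : M.natRk Ef.1 = k := rfl
      simp only [Finset.mem_filter, Finset.mem_univ, true_and, this]
      omega
  have hsum : ∑ F ∈ Finset.univ.filter (fun F : M.Flats => F.1 ⊆ M.E ∧ M.natRk F.1 + 2 ≤ k),
        X ^ M.natRk F.1 * (M ／ F.1).klPoly =
      D + ∑ i ∈ Finset.range (k - 1), (n.choose i : ℤ[X]) * (X ^ i * uniformKL (k - i) (n - i)) -
      ∑ H ∈ M.hyperplanes, ∑ i ∈ Finset.range (k - 1),
        (H.1.ncard.choose i : ℤ[X]) * (X ^ i * relaxKL (k - i) (H.1.ncard - i)) := by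
    rw [Finset.sum_congr rfl fun F hF => hlow F (Finset.mem_filter.1 hF).2.2,
      Finset.sum_sub_distrib, Finset.sum_add_distrib, Finset.sum_comm,
      hM.sum_flats subset_rfl (fun i => X ^ i * uniformKL (k - i) (n - i))]
    congr 1
    · congr 1
      rw [Finset.sum_ite_eq', if_pos]
      simp only [Finset.mem_filter, Finset.mem_univ, true_and, natRk_botFlat]
      exact ⟨M.botFlat.2.subset_ground, by omega⟩
    · refine Finset.sum_congr rfl fun H _ => ?_
      rw [← hM.sum_flats H.2.subset_ground
        (fun i => X ^ i * relaxKL (k - i) (H.1.ncard - i)), ← Finset.sum_filter,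
        Finset.filter_filter]
      refine Finset.sum_congr ?_ fun _ _ => rfl
      ext F
      simp only [Finset.mem_filter, Finset.mem_univ, true_and]
      exact ⟨fun h => ⟨h.2, h.1.2⟩, fun h => ⟨⟨F.2.subset_ground, h.2⟩, h.1⟩⟩
  -- The number of hyperplanes is rewritten so that the coefficient of t^(k-1) splits into the
  -- uniform one and one correction per hyperplane.
  have hcount : ((M.hyperplanes.card : ℕ) : ℤ[X]) = (n.choose (k - 1) : ℤ[X]) -
      ∑ H ∈ M.hyperplanes, ((H.1.ncard.choose (k - 1) : ℤ[X]) - 1) := by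
    rw [← hM.sum_choose_hyperplanes (by omega), Finset.sum_sub_distrib, ← hkdef]
    push_cast
    simp
  have hU : uniformZ k n = ∑ i ∈ Finset.range (k - 1),
      (n.choose i : ℤ[X]) * (X ^ i * uniformKL (k - i) (n - i)) +
        (n.choose (k - 1) : ℤ[X]) * X ^ (k - 1) + X ^ k := by
    rw [uniformZ]
    conv_lhs => rw [show k = (k - 1) + 1 by omega, Finset.sum_range_succ]
    rw [show k - 1 + 1 = k by omega, show k - (k - 1) = 1 by omega, uniformKL_one (by omega),
      mul_one]
  rw [hsplit, hsum, Finset.sum_congr rfl htop, Finset.sum_const, nsmul_eq_mul, hcount, hU]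
  simp only [relaxZ, Finset.sum_add_distrib, ← Finset.sum_mul]
  ring

/-- A polynomial of degree less than `k / 2` that is palindromic of degree `k` vanishes. -/
theorem eq_zero_of_reflect_eq {f : ℤ[X]} {k : ℕ} (h : f.reflect k = f)
    (h0 : ∀ i, k ≤ 2 * i → f.coeff i = 0) : f = 0 := by
  ext i
  rcases le_or_gt k (2 * i) with hi | hi
  · rw [h0 i hi, coeff_zero]
  · rw [← h, coeff_reflect, revAt_le (by omega), h0 _ (by omega), coeff_zero]

/-- All hyperplanes of U_{k,n} have k-1 elements, so every correction is zero, and the deviation of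
P is zero by definition of `uniformKL`. -/
theorem zPoly_uniformMatroid_aux {k n : ℕ} (hk : 2 ≤ k) (hkn : k ≤ n)
    (ih : ∀ k' < k, 1 ≤ k' → PavingKLFormula.{0} k') :
    (uniformMatroid k n).zPoly = uniformZ k n := by
  have := uniformMatroid_loopless (k := k) (n := n) (by omega)
  have hr := natRank_uniformMatroid hkn
  rw [(uniformMatroid_isPaving hkn).zPoly_eq_aux (by omega) (by rwa [hr]), hr,
    ncard_uniformMatroid_ground, Finset.sum_eq_zero, Finset.sum_eq_zero]
  · simp [uniformKL]
  · intro H hH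
    have := ncard_eq_of_mem_hyperplanes_uniformMatroid hkn hH
    rw [show H.1.ncard = k - 1 by omega, relaxZ_pred (by omega)]
  · intro H hH
    have := ncard_eq_of_mem_hyperplanes_uniformMatroid hkn hH
    rw [relaxKL, if_neg (by omega)]

theorem zPoly_uniformMatroid_one {n : ℕ} (hn : 1 ≤ n) :
    (uniformMatroid 1 n).zPoly = uniformZ 1 n := by
  have hr := natRank_uniformMatroid hn
  have h2 : uniformZ 1 n = 1 + X := by simp [uniformZ, uniformKL_one hn]
  have hd := (uniformMatroid 1 n).natDegree_zPoly
  have h1 := (uniformMatroid 1 n).zPoly_coeff_natRank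
  have h3 := (uniformMatroid 1 n).zPoly_reflect
  rw [hr] at h1 h3 hd
  have h0 : (uniformMatroid 1 n).zPoly.coeff 0 = 1 := by
    rw [← h3, coeff_reflect, revAt_le (by omega), Nat.sub_zero, h1]
  rw [h2, eq_X_add_C_of_natDegree_le_one hd.le, h0, h1]
  simp [add_comm]

theorem reflect_sub_eq (f g : ℤ[X]) (k : ℕ) :
    (f - g).reflect k = f.reflect k - g.reflect k := by
  rw [sub_eq_add_neg, reflect_add, reflect_neg, sub_eq_add_neg]

theorem relaxZ_reflect_aux {k h : ℕ} (hk : 2 ≤ k) (hkh : k ≤ h)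
    (ih : ∀ k' < k, 1 ≤ k' → PavingKLFormula.{0} k') :
    (relaxZ k h).reflect k = relaxZ k h := by
  have h1 : (uniformZ k (h + 1)).reflect k = uniformZ k (h + 1) := by
    rw [← zPoly_uniformMatroid_aux hk (by omega) ih]
    have := (uniformMatroid k (h + 1)).zPoly_reflect
    rwa [natRank_uniformMatroid (by omega)] at this
  have h2 : uniformZ (k - 1) h = (uniformMatroid (k - 1) h).zPoly := by
    rcases eq_or_ne k 2 with rfl | hne
    · exact (zPoly_uniformMatroid_one (by omega)).symm
    · exact (zPoly_uniformMatroid_aux (by omega) (by omega)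
        fun k' hk' => ih k' (by omega)).symm
  have hr : (uniformMatroid (k - 1) h).natRank = k - 1 := natRank_uniformMatroid (by omega)
  have h3 : ((1 + X) * uniformZ (k - 1) h).reflect k = (1 + X) * uniformZ (k - 1) h := by
    have := (uniformMatroid (k - 1) h).zPoly_reflect
    rw [hr] at this
    have hm := reflect_mul (1 + X) (uniformZ (k - 1) h) (F := 1) (G := k - 1)
      (by compute_degree) (by rw [h2, natDegree_zPoly, hr])
    rw [show 1 + (k - 1) = k by omega] at hm
    rw [hm, h2, this, reflect_add, reflect_one, reflect_one_X, pow_one, add_comm X]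
  rw [← uniformZ_sub_uniformZ hk hkh, reflect_sub_eq, h1, h3]

/-- The deviation D is a combination of Z-polynomials and `relaxZ` terms, all palindromic of degree
k, yet its degree is below k/2; hence it is zero. -/
theorem pavingKLFormula_step {k : ℕ} (hk : 2 ≤ k)
    (ih0 : ∀ k' < k, 1 ≤ k' → PavingKLFormula.{0} k')
    (ih : ∀ k' < k, 1 ≤ k' → PavingKLFormula.{u} k') : PavingKLFormula.{u} k := by
  intro α M _ _ hM hr
  have hkn : k ≤ M.E.ncard := hr ▸ M.natRk_le_ncard subset_rfl
  have hz := hM.zPoly_eq_aux (by omega) (by rwa [hr])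
  rw [hr] at hz
  set D := M.klPoly - (uniformKL k M.E.ncard - ∑ H ∈ M.hyperplanes, relaxKL k H.1.ncard) with hD
  have hD2 : D = M.zPoly - (uniformMatroid k M.E.ncard).zPoly +
      ∑ H ∈ M.hyperplanes, relaxZ k H.1.ncard := by
    rw [hz, zPoly_uniformMatroid_aux hk hkn ih0]
    ring
  have hrefl : D.reflect k = D := by
    have h1 := M.zPoly_reflect
    have h2 := (uniformMatroid k M.E.ncard).zPoly_reflect
    rw [hr] at h1
    rw [natRank_uniformMatroid hkn] at h2
    rw [hD2, reflect_add, reflect_sub_eq, h1, h2, reflect_sum]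
    congr 1
    refine Finset.sum_congr rfl fun H hH => ?_
    have h3 := mem_hyperplanes.1 hH
    have h4 := M.natRk_le_ncard H.2.subset_ground
    rcases le_or_gt k H.1.ncard with h | h
    · exact relaxZ_reflect_aux hk h ih0
    · rw [show H.1.ncard = k - 1 by omega, relaxZ_pred (by omega), reflect_zero]
  have hD0 := eq_zero_of_reflect_eq hrefl fun i hi => by
    have hi0 : i ≠ 0 := by omega
    rw [hD, coeff_sub, coeff_sub, klPoly_coeff_eq_zero M hi0 (by omega),
      uniformKL_coeff_eq_zero hkn hi0 hi, finsetSum_coeff,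
      Finset.sum_eq_zero fun H _ => relaxKL_coeff_eq_zero hi0 hi]
    simp
  exact sub_eq_zero.1 hD0

/-- The inductive step compares with uniform matroids, which live on `Fin n` in universe 0, so that
universe is settled before the general one. -/
theorem pavingKLFormula_zero_universe {k : ℕ} (hk : 1 ≤ k) : PavingKLFormula.{0} k := by
  induction k using Nat.strong_induction_on with
  | _ k ih =>
  rcases eq_or_ne k 1 with rfl | h
  · exact pavingKLFormula_one
  · exact pavingKLFormula_step (by omega) (fun k' h1 h2 => ih k' h1 h2)
      (fun k' h1 h2 => ih k' h1 h2)

theorem pavingKLFormula {k : ℕ} (hk : 1 ≤ k) : PavingKLFormula.{u} k := by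
  induction k using Nat.strong_induction_on with
  | _ k ih =>
  rcases eq_or_ne k 1 with rfl | h
  · exact pavingKLFormula_one
  · exact pavingKLFormula_step (by omega) (fun k' _ h2 => pavingKLFormula_zero_universe h2)
      (fun k' h1 h2 => ih k' h1 h2)

theorem zPoly_uniformMatroid {k n : ℕ} (hk : 1 ≤ k) (hkn : k ≤ n) :
    (uniformMatroid k n).zPoly = uniformZ k n := by
  rcases eq_or_ne k 1 with rfl | h
  · exact zPoly_uniformMatroid_one hkn
  · exact zPoly_uniformMatroid_aux (by omega) hkn fun _ _ h => pavingKLFormula h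

theorem relaxZ_reflect {k h : ℕ} (hk : 2 ≤ k) (hkh : k ≤ h) :
    (relaxZ k h).reflect k = relaxZ k h :=
  relaxZ_reflect_aux hk hkh fun _ _ h => pavingKLFormula h

/-- The `Z`-polynomial of a paving matroid of rank at least two. -/
theorem IsPaving.zPoly_eq {α : Type u} {M : Matroid α} [M.Finite] [M.Loopless]
    (hM : M.IsPaving) (hk : 2 ≤ M.natRank) :
    M.zPoly = (uniformMatroid M.natRank M.E.ncard).zPoly -
      ∑ H ∈ M.hyperplanes, relaxZ M.natRank H.1.ncard := by
  have hkn : M.natRank ≤ M.E.ncard := M.natRk_le_ncard subset_rfl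
  rw [hM.zPoly_eq_aux hk fun _ _ h => pavingKLFormula h,
    pavingKLFormula (by omega) α M hM rfl, zPoly_uniformMatroid (by omega) hkn]
  ring

end Matroid

/-! ### Expansion coefficients -/

theorem gammaCoeff_unique {f : ℤ[X]} {d : ℕ} {c : ℕ → ℤ}
    (hc : ∀ m, f.coeff m = ∑ i ∈ Finset.range (m + 1), c i * ((d - 2 * i).choose (m - i) : ℤ))
    (m : ℕ) : gammaCoeff f d m = c m := by
  induction m using Nat.strong_induction_on with
  | _ m ih =>
  have h := (gammaCoeff_eq f d m).symm.trans (hc m)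
  rw [Finset.sum_range_succ, Finset.sum_range_succ,
    Finset.sum_congr rfl fun i hi => by rw [ih i (Finset.mem_range.1 hi)]] at h
  simpa using h

theorem gammaCoeff_sub (f g : ℤ[X]) (d m : ℕ) :
    gammaCoeff (f - g) d m = gammaCoeff f d m - gammaCoeff g d m := by
  refine gammaCoeff_unique (c := fun m => gammaCoeff f d m - gammaCoeff g d m) (fun m => ?_) m
  rw [coeff_sub, gammaCoeff_eq f d m, gammaCoeff_eq g d m, ← Finset.sum_sub_distrib]
  exact Finset.sum_congr rfl fun i _ => by ring

theorem gammaCoeff_sum {ι : Type*} (s : Finset ι) (f : ι → ℤ[X]) (d m : ℕ) :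
    gammaCoeff (∑ j ∈ s, f j) d m = ∑ j ∈ s, gammaCoeff (f j) d m := by
  refine gammaCoeff_unique (c := fun m => ∑ j ∈ s, gammaCoeff (f j) d m) (fun m => ?_) m
  rw [finsetSum_coeff, Finset.sum_congr rfl fun j _ => gammaCoeff_eq (f j) d m, Finset.sum_comm]
  exact Finset.sum_congr rfl fun i _ => by rw [Finset.sum_mul]

theorem gammaCoeff_of_expansion {f : ℤ[X]} {d N : ℕ} {c : ℕ → ℤ}
    (hf : f = ∑ i ∈ Finset.range N, C (c i) * (X ^ i * (1 + X) ^ (d - 2 * i))) (m : ℕ) :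
    gammaCoeff f d m = if m < N then c m else 0 := by
  refine gammaCoeff_unique (c := fun m => if m < N then c m else 0) (fun m => ?_) m
  rw [hf, finsetSum_coeff]
  simp only [coeff_C_mul, coeff_X_pow_mul_one_add_X_pow]
  have h1 : ∀ i, c i * (if i ≤ m then ((d - 2 * i).choose (m - i) : ℤ) else 0) =
      if i ≤ m then c i * ((d - 2 * i).choose (m - i) : ℤ) else 0 := fun i => by
    split_ifs <;> simp
  have h2 : ∀ i, (if i < N then c i else 0) * ((d - 2 * i).choose (m - i) : ℤ) =
      if i < N then c i * ((d - 2 * i).choose (m - i) : ℤ) else 0 := fun i => by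
    split_ifs <;> simp
  simp only [h1, h2]
  rw [← Finset.sum_filter, ← Finset.sum_filter]
  refine Finset.sum_congr ?_ fun _ _ => rfl
  ext i
  simp only [Finset.mem_filter, Finset.mem_range]
  omega

/-- The `γ`-polynomial with respect to a prescribed degree. -/
noncomputable def gammaTrunc (d : ℕ) (f : ℤ[X]) : ℤ[X] :=
  ∑ i ∈ Finset.range (d / 2 + 1), monomial i (gammaCoeff f d i)

theorem gammaTrunc_coeff (d : ℕ) (f : ℤ[X]) (i : ℕ) :
    (gammaTrunc d f).coeff i = if i ≤ d / 2 then gammaCoeff f d i else 0 := by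
  simp [gammaTrunc, coeff_monomial]

theorem gammaTrunc_sub (d : ℕ) (f g : ℤ[X]) :
    gammaTrunc d (f - g) = gammaTrunc d f - gammaTrunc d g := by
  simp [gammaTrunc, gammaCoeff_sub, Finset.sum_sub_distrib]

theorem gammaTrunc_sum {ι : Type*} (s : Finset ι) (f : ι → ℤ[X]) (d : ℕ) :
    gammaTrunc d (∑ j ∈ s, f j) = ∑ j ∈ s, gammaTrunc d (f j) := by
  simp only [gammaTrunc, gammaCoeff_sum, map_sum]
  rw [Finset.sum_comm]

theorem gammaTrunc_zero (d : ℕ) : gammaTrunc d 0 = 0 := by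
  simpa using gammaTrunc_sum (∅ : Finset ℕ) (fun _ => 0) d

/-- Multiplication by 1+t raises every exponent of 1+t in the expansion by one and keeps the
coefficients. If the degree is odd, the extra index allowed by the new degree carries the
coefficient zero. -/
theorem gammaTrunc_one_add_X_mul {f : ℤ[X]} (hf : f.reflect f.natDegree = f) :
    gammaTrunc (f.natDegree + 1) ((1 + X) * f) = gammaPoly f := by
  have h1 := gammaPoly_expansion f hf
  have h2 : (1 + X) * f = ∑ i ∈ Finset.range (f.natDegree / 2 + 1),
      C ((gammaPoly f).coeff i) * (X ^ i * (1 + X) ^ (f.natDegree + 1 - 2 * i)) := by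
    conv_lhs => rw [h1]
    rw [Finset.mul_sum]
    refine Finset.sum_congr rfl fun i hi => ?_
    have := Finset.mem_range.1 hi
    rw [show f.natDegree + 1 - 2 * i = f.natDegree - 2 * i + 1 by omega, pow_succ]
    ring
  ext i
  rw [gammaTrunc_coeff, gammaCoeff_of_expansion h2, gammaPoly_coeff]
  split_ifs <;> first | rfl | omega

namespace Matroid

variable {α : Type*}

theorem gamma_eq (M : Matroid α) [M.Finite] : M.gamma = gammaTrunc M.natRank M.zPoly := by
  rw [gamma, gammaPoly, natDegree_zPoly, gammaTrunc]

theorem gamma_eq_one (M : Matroid α) [M.Finite] (h : M.natRank ≤ 1) : M.gamma = 1 := by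
  have h0 : M.zPoly.coeff 0 = 1 := by
    rw [← M.zPoly_reflect, coeff_reflect, revAt_le (Nat.zero_le _), Nat.sub_zero,
      zPoly_coeff_natRank]
  have h1 : gammaCoeff M.zPoly M.natRank 0 = 1 := by
    rw [gammaCoeff]
    simp [h0]
  rw [gamma_eq, gammaTrunc, show M.natRank / 2 + 1 = 1 by omega]
  simp [h1]

end Matroid

/-! ### The polynomial g as the γ-polynomial of `relaxZ`, and its coefficients. -/

theorem gPoly_one {h : ℕ} (hh : 1 ≤ h) : gPoly 1 h = 0 := by
  have h1 : (uniformMatroid 1 (h + 1)).natRank = 1 := natRank_uniformMatroid (by omega)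
  have h2 : (uniformMatroid (1 - 1) h).natRank = 1 - 1 := natRank_uniformMatroid (by omega)
  rw [gPoly, Matroid.gamma_eq_one _ (by omega), Matroid.gamma_eq_one _ (by omega), sub_self]

theorem gPoly_eq {k h : ℕ} (hk : 2 ≤ k) (hkh : k ≤ h) : gPoly k h = gammaTrunc k (relaxZ k h) := by
  have h1 : (uniformMatroid k (h + 1)).natRank = k := natRank_uniformMatroid (by omega)
  have h2 : (uniformMatroid (k - 1) h).natRank = k - 1 := natRank_uniformMatroid (by omega)
  have h3 := (uniformMatroid (k - 1) h).natDegree_zPoly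
  have h4 := gammaTrunc_one_add_X_mul (f := (uniformMatroid (k - 1) h).zPoly)
    (by rw [h3]; exact Matroid.zPoly_reflect _)
  rw [h3, h2, show k - 1 + 1 = k by omega] at h4
  rw [← uniformZ_sub_uniformZ hk hkh, gammaTrunc_sub, ← Matroid.zPoly_uniformMatroid (by omega)
    (by omega), ← Matroid.zPoly_uniformMatroid (by omega) (by omega), h4, gPoly,
    Matroid.gamma_eq, h1, Matroid.gamma]

theorem relaxZ_coeff_eq_zero {k h j : ℕ} (hk : 2 ≤ k) (hkh : k ≤ h) (hj : k < j) :
    (relaxZ k h).coeff j = 0 := by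
  have h1 : (uniformMatroid k (h + 1)).natRank = k := natRank_uniformMatroid (by omega)
  have h2 : (uniformMatroid (k - 1) h).natRank = k - 1 := natRank_uniformMatroid (by omega)
  obtain ⟨j, rfl⟩ : ∃ j', j = j' + 1 := ⟨j - 1, by omega⟩
  rw [← uniformZ_sub_uniformZ hk hkh, ← Matroid.zPoly_uniformMatroid (by omega)
    (by omega), ← Matroid.zPoly_uniformMatroid (by omega) (by omega), add_mul, one_mul, coeff_sub,
    coeff_add, coeff_X_mul, Matroid.zPoly_coeff_eq_zero _ (by omega),
    Matroid.zPoly_coeff_eq_zero _ (by omega), Matroid.zPoly_coeff_eq_zero _ (by omega)]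
  simp

theorem relaxZ_one (h : ℕ) : relaxZ 1 h = 0 := by
  simp [relaxZ]

/-- Binomial inversion. -/
theorem sum_alternating_choose_mul_sum {R : Type*} [CommRing R] {k n : ℕ} (hk : 1 ≤ k) (x : R)
    (q : ℕ → R) :
    ∑ i ∈ Finset.range k, (-1) ^ i * (n.choose i : R) * x ^ i *
      ∑ l ∈ Finset.range (k - i), ((n - i).choose l : R) * (x ^ l * q (k - i - l)) = q k := by
  have h1 : ∀ i ∈ Finset.range k, (-1) ^ i * (n.choose i : R) * x ^ i *
      ∑ l ∈ Finset.range (k - i), ((n - i).choose l : R) * (x ^ l * q (k - i - l)) =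
      ∑ l ∈ Finset.range (k - i), (-1) ^ i * ((n.choose i : R) * ((n - i).choose l : R)) *
        (x ^ (i + l) * q (k - (i + l))) := by
    intro i _
    rw [Finset.mul_sum]
    refine Finset.sum_congr rfl fun l _ => ?_
    rw [Nat.sub_sub, pow_add]
    ring
  -- Collect the terms with i + l = s. Their coefficient is binom(n, s) times the alternating sum of
  -- binom(s, i), which is zero unless s = 0.
  rw [Finset.sum_congr rfl h1, ← Finset.sum_range_diag_flip k (fun i l =>
    (-1) ^ i * ((n.choose i : R) * ((n - i).choose l : R)) * (x ^ (i + l) * q (k - (i + l))))]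
  have h2 : ∀ s ∈ Finset.range k, ∑ i ∈ Finset.range (s + 1),
      (-1) ^ i * ((n.choose i : R) * ((n - i).choose (s - i) : R)) *
        (x ^ (i + (s - i)) * q (k - (i + (s - i)))) = if s = 0 then q k else 0 := by
    intro s hs
    have hs := Finset.mem_range.1 hs
    have h3 : ∀ i ∈ Finset.range (s + 1),
      (-1) ^ i * ((n.choose i : R) * ((n - i).choose (s - i) : R)) *
        (x ^ (i + (s - i)) * q (k - (i + (s - i)))) =
        ((((-1) ^ i * (s.choose i : ℤ) : ℤ)) : R) * ((n.choose s : R) * (x ^ s * q (k - s))) := by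
      intro i hi
      have hi := Finset.mem_range.1 hi
      rw [show i + (s - i) = s by omega, ← Nat.cast_mul,
        ← Nat.choose_mul (by omega : i ≤ s)]
      push_cast
      ring
    rw [Finset.sum_congr rfl h3, ← Finset.sum_mul, ← Int.cast_sum,
      Int.alternating_sum_range_choose]
    split_ifs with h0
    · subst h0
      simp
    · simp
  rw [Finset.sum_congr rfl h2, Finset.sum_ite_eq', if_pos (Finset.mem_range.2 (by omega))]

/-- With m fixed, `relaxZ k (k+m)` plus t^(k-1) is a binomial transform of the `relaxKL` family.
Inverting it isolates a polynomial of degree below k/2; the right side is what the powers t^(k-1)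
leave behind. -/
theorem sum_alternating_choose_mul_relaxZ_coeff {k m b : ℕ} (hk : 2 ≤ k) (hb : 2 * b ≤ k) :
    ∑ i ∈ Finset.range k, (-1 : ℤ) ^ i * ((k + m).choose i : ℤ) *
      (relaxZ (k - i) (k - i + m)).coeff b =
      if b = 1 then (-1) ^ k * ((k + m - 1).choose (k - 1) : ℤ) else 0 := by
  set q : ℕ → ℤ[X] := fun k => if k = 1 then 1 else relaxKL k (k + m) with hq
  have hp : ∀ k, 1 ≤ k → relaxZ k (k + m) =
      ∑ l ∈ Finset.range k, ((k + m).choose l : ℤ[X]) * (X ^ l * q (k - l)) - X ^ (k - 1) := by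
    intro k hk
    obtain ⟨k, rfl⟩ : ∃ k', k = k' + 1 := ⟨k - 1, by omega⟩
    rw [relaxZ, Finset.sum_range_succ, Nat.add_sub_cancel, Nat.add_sub_cancel_left]
    have h1 : ∑ l ∈ Finset.range k, ((k + 1 + m).choose l : ℤ[X]) * (X ^ l * q (k + 1 - l)) =
        ∑ i ∈ Finset.range k, ((k + 1 + m).choose i : ℤ[X]) *
          (X ^ i * relaxKL (k + 1 - i) (k + 1 + m - i)) := by
      refine Finset.sum_congr rfl fun l hl => ?_
      have := Finset.mem_range.1 hl
      simp only [hq]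
      rw [if_neg (by omega), show k + 1 - l + m = k + 1 + m - l by omega]
    rw [h1]
    simp only [hq, if_true]
    ring
  have hinv := sum_alternating_choose_mul_sum (R := ℤ[X]) (k := k) (n := k + m) (by omega) X q
  have hsum : ∑ i ∈ Finset.range k, (-1 : ℤ[X]) ^ i * ((k + m).choose i : ℤ[X]) * X ^ i *
      relaxZ (k - i) (k - i + m) =
      q k - C ((-1) ^ (k - 1) * ((k + m - 1).choose (k - 1) : ℤ)) * X ^ (k - 1) := by
    have h2 := Int.alternating_sum_range_choose_eq_choose (n := k + m - 1) (m := k - 1)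
    rw [show k - 1 + 1 = k by omega, show k + m - 1 + 1 = k + m by omega] at h2
    rw [← hinv, ← h2, map_sum, Finset.sum_mul, ← Finset.sum_sub_distrib]
    refine Finset.sum_congr rfl fun i hi => ?_
    have hi := Finset.mem_range.1 hi
    have e : (X : ℤ[X]) ^ (k - 1) = X ^ i * X ^ (k - i - 1) := by
      rw [← pow_add]; congr 1; omega
    rw [hp (k - i) (by omega), show k - i + m = k + m - i by omega, e]
    simp only [map_mul, map_pow, map_neg, map_one, map_natCast]
    ring
  -- Because 2(k-b) ≥ k, `q k` has no such coefficient. By palindromicity the coefficient at k-b-i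
  -- of `relaxZ (k-i) (k-i+m)` is the one at b.
  have hcoeff := congrArg (fun p => p.coeff (k - b)) hsum
  simp only [finsetSum_coeff, coeff_sub, coeff_C_mul, coeff_X_pow] at hcoeff
  have hq0 : (q k).coeff (k - b) = 0 := by
    simp only [hq]
    rw [if_neg (by omega)]
    exact relaxKL_coeff_eq_zero (by omega) (by omega)
  rw [hq0] at hcoeff
  refine Eq.trans (Finset.sum_congr rfl fun i hi => ?_) (hcoeff.trans ?_)
  · have hi := Finset.mem_range.1 hi
    have e : (-1 : ℤ[X]) ^ i * ((k + m).choose i : ℤ[X]) * X ^ i * relaxZ (k - i) (k - i + m) =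
        C ((-1 : ℤ) ^ i * ((k + m).choose i : ℤ)) * (X ^ i * relaxZ (k - i) (k - i + m)) := by
      simp only [map_mul, map_pow, map_neg, map_one, map_natCast]
      ring
    rw [e, coeff_C_mul, coeff_X_pow_mul']
    congr 1
    rcases eq_or_ne (k - i) 1 with h1 | h1
    · rw [h1, relaxZ_one]
      simp
    · split_ifs with h2
      · conv_rhs => rw [← Matroid.relaxZ_reflect (k := k - i) (h := k - i + m) (by omega)
          (by omega), coeff_reflect, revAt_le (show k - b - i ≤ k - i by omega)]
        congr 1
        omega
      · exact relaxZ_coeff_eq_zero (by omega) (by omega) (by omega)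
  · by_cases h1 : b = 1
    · subst h1
      obtain ⟨k, rfl⟩ : ∃ k', k = k' + 1 := ⟨k - 1, by omega⟩
      simp [pow_succ]
    · rw [if_neg h1, if_neg (by omega)]
      simp

theorem pNum_eq_zero {m k b : ℕ} (hk : 1 ≤ k) (hb : k < b) : pNum m k b = 0 := by
  refine Finset.sum_eq_zero fun l hl => ?_
  have := Finset.mem_range.1 hl
  rcases lt_or_ge k (2 * l + 2) with h | h
  · rw [gNum_eq_zero m hk h, zero_mul]
  · rw [Nat.choose_eq_zero_of_lt (by omega)]
    simp

theorem pNum_symm {m k b : ℕ} (hk : 1 ≤ k) (hb : b ≤ k) : pNum m k (k - b) = pNum m k b := by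
  have h : ∀ b ≤ k, pNum m k b = ∑ l ∈ Finset.range k,
      if l < b then gNum l m k * ((k - (2 * l + 2)).choose (b - 1 - l) : ℚ) else 0 := by
    intro b hb
    rw [← Finset.sum_filter, pNum]
    refine Finset.sum_congr ?_ fun _ _ => rfl
    ext l
    simp only [Finset.mem_filter, Finset.mem_range]
    omega
  rw [h b hb, h (k - b) (by omega)]
  refine Finset.sum_congr rfl fun l _ => ?_
  rcases lt_or_ge k (2 * l + 2) with h0 | h0
  · simp [gNum_eq_zero m hk h0]
  split_ifs with h1 h2 h2
  · rw [Nat.choose_symm_of_eq_add (by omega : k - (2 * l + 2) = (k - b - 1 - l) + (b - 1 - l))]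
  · rw [Nat.choose_eq_zero_of_lt (by omega)]
    simp
  · rw [Nat.choose_eq_zero_of_lt (by omega)]
    simp
  · rfl

/-- For 2b ≤ k both sides satisfy the same recursion, whose term i = 0 is the value at k; induction
on k gives equality. Palindromicity of both sides covers the remaining b ≤ k. -/
theorem relaxZ_coeff (m : ℕ) {k : ℕ} (hk : 1 ≤ k) (b : ℕ) :
    ((relaxZ k (k + m)).coeff b : ℚ) = pNum m k b := by
  induction k using Nat.strong_induction_on generalizing b with
  | _ k ih =>
  rcases eq_or_ne k 1 with rfl | hne
  · rw [relaxZ_one, coeff_zero, pNum, Finset.sum_eq_zero]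
    · simp
    · intro l _
      rw [gNum_eq_zero m le_rfl (by omega), zero_mul]
  have hk2 : 2 ≤ k := by omega
  have hlow : ∀ b, 2 * b ≤ k → ((relaxZ k (k + m)).coeff b : ℚ) = pNum m k b := by
    intro b hb
    have h1 := sum_alternating_choose_mul_pNum (m := m) hk2 hb
    have h2 := congrArg (fun z : ℤ => (z : ℚ))
      (sum_alternating_choose_mul_relaxZ_coeff (m := m) hk2 hb)
    have h3 := Eq.trans (b := if b = 1 then (-1) ^ k * ((k + m - 1).choose (k - 1) : ℚ) else 0)
      (by simpa using h2) h1.symm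
    obtain ⟨k, rfl⟩ : ∃ k', k = k' + 1 := ⟨k - 1, by omega⟩
    rw [Finset.sum_range_succ', Finset.sum_range_succ', Finset.sum_congr rfl fun i hi => by
      rw [ih (k + 1 - (i + 1)) (by omega) (by have := Finset.mem_range.1 hi; omega) b]] at h3
    simpa using h3
  rcases le_or_gt (2 * b) k with hb | hb
  · exact hlow b hb
  rcases le_or_gt b k with hbk | hbk
  · rw [← pNum_symm hk hbk, ← hlow (k - b) (by omega), ← Matroid.relaxZ_reflect hk2 (by omega),
      coeff_reflect, revAt_le hbk, Matroid.relaxZ_reflect hk2 (by omega)]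
  · rw [pNum_eq_zero hk hbk, relaxZ_coeff_eq_zero hk2 (by omega) hbk]
    simp

/-- The system defining the γ-coefficients is triangular, and `pNum` is built as its value on the
list 0, `gNum 0 m k`, `gNum 1 m k`, .... -/
theorem gammaCoeff_relaxZ (m : ℕ) {k : ℕ} (hk : 1 ≤ k) (i : ℕ) :
    (gammaCoeff (relaxZ k (k + m)) k i : ℚ) = if i = 0 then 0 else gNum (i - 1) m k := by
  induction i using Nat.strong_induction_on with
  | _ i ih =>
  have h := congrArg (fun z : ℤ => (z : ℚ)) (gammaCoeff_eq (relaxZ k (k + m)) k i)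
  simp only [relaxZ_coeff m hk, Int.cast_sum, Int.cast_mul] at h
  rw [Finset.sum_range_succ,
    Finset.sum_congr rfl fun j hj => by rw [ih j (Finset.mem_range.1 hj)]] at h
  rcases i with _ | i
  · simp [pNum] at h
    simp [← h]
  · rw [Finset.sum_range_succ', pNum, Finset.sum_range_succ] at h
    have e : ∀ l ∈ Finset.range i, (if l + 1 = 0 then (0 : ℚ) else gNum (l + 1 - 1) m k) *
        (((k - 2 * (l + 1)).choose (i + 1 - (l + 1)) : ℤ) : ℚ) =
        gNum l m k * ((k - (2 * l + 2)).choose (i + 1 - 1 - l) : ℚ) := by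
      intro l _
      rw [if_neg (by omega), Nat.add_sub_cancel, Nat.add_sub_add_right, Nat.add_sub_cancel, mul_add]
      simp
    rw [Finset.sum_congr rfl e] at h
    simp at h
    simp [← h]

theorem gPoly_coeff_cast {k h : ℕ} (hk : 2 ≤ k) (hkh : k ≤ h) (i : ℕ) :
    ((gPoly k h).coeff i : ℚ) =
      if 1 ≤ i ∧ i ≤ k / 2 then gNum (i - 1) (h - k) k else 0 := by
  obtain ⟨m, rfl⟩ := Nat.exists_eq_add_of_le hkh
  rw [gPoly_eq hk hkh, gammaTrunc_coeff, Nat.add_sub_cancel_left]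
  split_ifs with h1 h2 h2
  · rw [gammaCoeff_relaxZ m (by omega), if_neg (by omega)]
  · rw [gammaCoeff_relaxZ m (by omega), if_pos (by omega)]
  · omega
  · simp

/-! ### Counting hyperplanes by cardinality and conclusion. -/

namespace Matroid

variable {α : Type*}

theorem numHyperplanes_eq (M : Matroid α) [M.Finite] (h : ℕ) :
    M.numHyperplanes h = (M.hyperplanes.filter fun H => H.1.ncard = h).card := by
  rw [numHyperplanes, ← Set.ncard_coe_finset, ← Set.ncard_image_of_injective _
    (Subtype.val_injective (p := fun F => M.IsFlat F))]
  congr 1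
  ext H
  simp only [Set.mem_ofPred_eq, Set.mem_image, Finset.mem_coe, Finset.mem_filter, mem_hyperplanes,
    Subtype.exists, exists_and_right, exists_eq_right, IsHyperplaneFlat]
  rw [← cast_natRank, ← cast_natRk]
  constructor
  · rintro ⟨⟨h1, h2⟩, h3⟩
    refine ⟨⟨h1, by exact_mod_cast h2⟩, ?_⟩
    rw [Set.ncard, h3]
    simp
  · rintro ⟨⟨h1, h2⟩, h3⟩
    refine ⟨⟨h1, by exact_mod_cast h2⟩, ?_⟩
    rw [← (M.ground_finite.subset h1.subset_ground).cast_ncard_eq, h3]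

theorem IsPaving.loopless {M : Matroid α} [M.Finite] (hM : M.IsPaving) (hk : 2 ≤ M.natRank) :
    M.Loopless := by
  rw [loopless_iff_forall_isCircuit]
  intro K hK
  have h := hM K hK
  rw [← cast_natRank] at h
  rw [← Set.one_lt_encard_iff_nontrivial]
  refine lt_of_lt_of_le ?_ h
  exact_mod_cast hk

theorem IsPaving.gamma_eq {M : Matroid α} [M.Finite] (hM : M.IsPaving) (hk : 2 ≤ M.natRank) :
    M.gamma = (uniformMatroid M.natRank M.E.ncard).gamma -
      ∑ h ∈ Finset.Icc M.natRank M.E.ncard, M.numHyperplanes h • gPoly M.natRank h := by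
  classical
  have := hM.loopless hk
  have hkn : M.natRank ≤ M.E.ncard := M.natRk_le_ncard subset_rfl
  rw [Matroid.gamma_eq, hM.zPoly_eq hk, gammaTrunc_sub, gammaTrunc_sum, Matroid.gamma_eq,
    natRank_uniformMatroid hkn]
  congr 1
  -- Hyperplanes with fewer than k elements have exactly k-1 and contribute zero. The others are
  -- grouped by cardinality, which lies between k and n.
  rw [← Finset.sum_filter_add_sum_filter_not _ (fun H : M.Flats => M.natRank ≤ H.1.ncard),
    Finset.sum_eq_zero (s := M.hyperplanes.filter fun H : M.Flats => ¬ M.natRank ≤ H.1.ncard),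
    add_zero, ← Finset.sum_fiberwise_of_maps_to (t := Finset.Icc M.natRank M.E.ncard)
      (g := fun H : M.Flats => H.1.ncard)]
  · refine Finset.sum_congr rfl fun h hh => ?_
    have hh := Finset.mem_Icc.1 hh
    rw [numHyperplanes_eq, ← Finset.sum_const, gPoly_eq hk hh.1]
    refine Finset.sum_congr ?_ ?_
    · ext H
      simp only [Finset.mem_filter]
      constructor
      · rintro ⟨⟨h1, _⟩, h2⟩
        exact ⟨h1, h2⟩
      · rintro ⟨h1, h2⟩
        exact ⟨⟨h1, by omega⟩, h2⟩
    · intro H hH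
      rw [(Finset.mem_filter.1 hH).2]
  · intro H hH
    exact Finset.mem_Icc.2 ⟨(Finset.mem_filter.1 hH).2,
      Set.ncard_le_ncard H.2.subset_ground M.ground_finite⟩
  · intro H hH
    obtain ⟨h1, h2⟩ := Finset.mem_filter.1 hH
    have h3 := mem_hyperplanes.1 h1
    have h4 := M.natRk_le_ncard H.2.subset_ground
    rw [show H.1.ncard = M.natRank - 1 by omega, relaxZ_pred (by omega), gammaTrunc_zero]

end Matroid

theorem theorem1p6 :
    (∀ (α : Type*) (M : Matroid α) [M.Finite] (k n : ℕ),
      M.IsPaving → M.eRank = k → M.E.encard = n →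
        M.gamma = (uniformMatroid k n).gamma -
          ∑ h ∈ Finset.Icc k n, M.numHyperplanes h • gPoly k h) ∧
    (∀ k h : ℕ, 1 ≤ k → k ≤ h →
      (∀ i, 0 ≤ (gPoly k h).coeff i) ∧ (gPoly k h).natDegree = k / 2) := by
  constructor
  · intro α M _ k n hM hk hn
    have hk' : M.natRank = k := by rw [Matroid.natRank_eq, hk, ENat.toNat_natCast]
    have hn' : M.E.ncard = n := by rw [Set.ncard, hn, ENat.toNat_natCast]
    rcases le_or_gt 2 k with h2 | h2
    · subst hk' hn'
      exact hM.gamma_eq h2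
    -- In rank at most one both γ-polynomials are 1. The sum vanishes because g_{1,h} = 0, and
    -- because there are no hyperplanes in rank 0.
    · have hkn : k ≤ n := by
        rw [← hk', ← hn']
        exact M.natRk_le_ncard subset_rfl
      rw [M.gamma_eq_one (by omega), Matroid.gamma_eq_one _
        (by rw [natRank_uniformMatroid hkn]; omega), Finset.sum_eq_zero, sub_zero]
      intro h hh
      have hh := Finset.mem_Icc.1 hh
      rcases eq_or_ne k 1 with rfl | h1
      · rw [gPoly_one hh.1, smul_zero]
      · have h0 : k = 0 := by omega
        have : M.numHyperplanes h = 0 := by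
          rw [Matroid.numHyperplanes_eq, Finset.card_eq_zero, Finset.filter_eq_empty_iff]
          intro H hH
          have := Matroid.mem_hyperplanes.1 hH
          omega
        rw [this, zero_smul]
  · intro k h hk hkh
    rcases eq_or_ne k 1 with rfl | h1
    · rw [gPoly_one hkh]
      simp
    have hk2 : 2 ≤ k := by omega
    have hc := gPoly_coeff_cast hk2 hkh
    refine ⟨fun i => ?_, le_antisymm ?_ ?_⟩
    · have : (0 : ℚ) ≤ ((gPoly k h).coeff i : ℚ) := by
        rw [hc]
        split_ifs
        · exact gNum_nonneg _ _ _
        · exact le_rfl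
      exact_mod_cast this
    · refine natDegree_le_iff_coeff_eq_zero.2 fun i hi => ?_
      have := hc i
      rw [if_neg (by omega)] at this
      exact_mod_cast this
    -- The coefficient at k/2 is `gNum` with l = k/2 - 1, the largest l with 2l+2 ≤ k, so it is
    -- still positive.
    · refine le_natDegree_of_ne_zero fun h0 => ?_
      have := hc (k / 2)
      rw [if_pos (by omega), h0] at this
      exact (gNum_pos (l := k / 2 - 1) (h - k) (by omega : 2 * (k / 2 - 1) + 2 ≤ k)).ne
        (by simpa using this)
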